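/- Let $q,a,b,c,d\in\mathbb{C}$ with $q\neq0$, $q^m\neq1$ for $m=1,2,\ldots$, $a,b,c,d\neq0$, and $abcd\neq q^{-m}$ for $m=0,1,2,\ldots$. Let $e_1=a+b+c+d$, $e_2=ab+ac+bc+ad+bd+cd$, $e_3=abc+abd+acd+bcd$, $e_4=abcd$, and put $$\begin{aligned} B&=(1-q^{-1})^2(e_3+qe_1),\qquad C_0=(q-q^{-1})^2,\qquad C_1=q^{-1}(q-q^{-1})^2e_4,\\ D_0&=-q^{-3}(1-q)^2(1+q)(e_4+qe_2+q^2),\qquad D_1=-q^{-3}(1-q)^2(1+q)(e_1e_4+qe_3),\\ E&=-q^{-2}(1-q)^3(c+d),\qquad F_0=q^{-3}(1-q)^3(1+q)(cd+q),\qquad F_1=q^{-3}(1-q)^3(1+q)(a+b)cd,\\ G&=-q^{-4}(1-q)^3\Bigl((a+b)(c+d)\bigl(cd(q^2+1)+q\bigr)-q(ab+1)\bigl((c^2+d^2)(q+1)-cd\bigr)\\ &\qquad+(cd+e_4)(q^2+1)+(e_2+e_4-ab)q^3\Bigr),\\ Q_0&=q^{-4}(1-q)^2\Bigl(q^4(e_4-e_2)+q^3(e_1^2-e_1e_3-2e_2)-q^2(e_2e_4+2e_4+e_2)\\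 &\qquad+q(e_3^2-2e_2e_4-e_1e_3)+e_4(1-e_2)\Bigr). \end{aligned}$$ Let $AW(3,Q_0)^\sim$ be the unital associative $\mathbb{C}$-algebra generated by $K_0,K_1,T_1$ with relations $$T_1K_0=K_0T_1,\qquad T_1K_1=K_1T_1,\qquad (T_1+ab)(T_1+1)=0,$$ $$(q+q^{-1})K_1K_0K_1-K_1^2K_0-K_0K_1^2=BK_1+C_0K_0+D_0+EK_1(T_1+ab)+F_0(T_1+ab),$$ $$(q+q^{-1})K_0K_1K_0-K_0^2K_1-K_1K_0^2=BK_0+C_1K_1+D_1+EK_0(T_1+ab)+F_1(T_1+ab),$$ and $\widetilde Q=Q_0$, where $$\begin{aligned} \widetilde Q={}&(K_1K_0)^2-(q^2+1+q^{-2})K_0(K_1K_0)K_1+(q+q^{-1})K_0^2K_1^2+(q+q^{-1})(C_0K_0^2+C_1K_1^2)\\ &+\bigl(B+E(T_1+ab)\bigr)\bigl((q+1+q^{-1})K_0K_1+K_1K_0\bigr)+(q+1+q^{-1})\bigl(D_0+F_0(T_1+ab)\bigr)K_0\\ &+(q+1+q^{-1})\bigl(D_1+F_1(T_1+ab)\bigr)K_1+G(T_1+ab).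 \end{aligned}$$ On the space $\mathbb{C}[z,z^{-1}]$ of Laurent polynomials consider the (well-defined, invertible) operators $$(\mathcal T_1f)[z]=\frac{(a+b)z-(1+ab)}{1-z^2}f[z]+\frac{(1-az)(1-bz)}{1-z^2}f[z^{-1}],$$ $$(\mathcal T_0f)[z]=\frac{q^{-1}z\bigl((cd+q)z-(c+d)q\bigr)}{q-z^2}f[z]-\frac{(c-z)(d-z)}{q-z^2}f[qz^{-1}],$$ and let $Y=\mathcal T_1\mathcal T_0$ and $D=Y+q^{-1}abcd\,Y^{-1}$. **Theorem.** There is a representation of $AW(3,Q_0)^\sim$ on $\mathbb{C}[z,z^{-1}]$ such that $K_0$ acts as $D$, $K_1$ acts as multiplication by $z+z^{-1}$, and $T_1$ acts as $\mathcal T_1$. This representation is faithful. Moreover, the elements $$K_0^n(K_1K_0)^iK_1^mT_1^j\qquad(m,n=0,1,2,\ldots,\ i,j\in\{0,1\})$$ span $AW(3,Q_0)^\sim$ as a complex vector space. -/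

import Mathlib

open scoped LaurentPolynomial

namespace Zhedanov

noncomputable section

open LaurentPolynomial

/-! ## Operators on Laurent polynomials in one variable `z` (written `T 1`) -/

/-- The linear operator on Laurent polynomials with prescribed values `z ^ n ↦ g n`. -/
def ofMonomials (g : ℤ → ℂ[T;T⁻¹]) : ℂ[T;T⁻¹] →ₗ[ℂ] ℂ[T;T⁻¹] :=
  Finsupp.linearCombination ℂ g ∘ₗ (AddMonoidAlgebra.coeffLinearEquiv ℂ).toLinearMap

/-- The substitution `f[z] ↦ f[p z⁻¹]`, that is `z ^ n ↦ p ^ n z ^ (-n)`. -/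
def reflect (p : ℂ) : ℂ[T;T⁻¹] →ₗ[ℂ] ℂ[T;T⁻¹] :=
  ofMonomials fun n => C (p ^ n) * T (-n)

/-- The quotient `(z ^ n - p ^ n z ^ (-n)) / (p - z ^ 2)`, written out as a geometric sum. -/
def divDiffMonomial (p : ℂ) : ℤ → ℂ[T;T⁻¹]
  | Int.ofNat n => -(T (-(n : ℤ)) * ∑ k ∈ Finset.range n, C (p ^ (n - 1 - k)) * T 2 ^ k)
  | Int.negSucc m => C ((p ^ (m + 1))⁻¹) * T (-((m : ℤ) + 1)) *
      ∑ k ∈ Finset.range (m + 1), C (p ^ (m - k)) * T 2 ^ k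

/-- The divided difference `f[z] ↦ (f[z] - f[p z⁻¹]) / (p - z ^ 2)`; see `mul_divDiff`. -/
def divDiff (p : ℂ) : ℂ[T;T⁻¹] →ₗ[ℂ] ℂ[T;T⁻¹] :=
  ofMonomials (divDiffMonomial p)

theorem ofMonomials_C_mul_T (g : ℤ → ℂ[T;T⁻¹]) (r : ℂ) (n : ℤ) :
    ofMonomials g (C r * T n) = C r * g n := by
  rw [← single_eq_C_mul_T, ← smul_eq_C_mul]
  simp [ofMonomials, -single_eq_C_mul_T]

theorem ofMonomials_T (g : ℤ → ℂ[T;T⁻¹]) (n : ℤ) : ofMonomials g (T n) = g n := by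
  simpa using ofMonomials_C_mul_T g 1 n

theorem reflect_T (p : ℂ) (n : ℤ) : reflect p (T n) = C (p ^ n) * T (-n) :=
  ofMonomials_T _ n

theorem reflect_one_eq_invert (f : ℂ[T;T⁻¹]) : reflect 1 f = invert f := by
  induction f using LaurentPolynomial.induction_on' with
  | add f g hf hg => rw [map_add, map_add, hf, hg]
  | C_mul_T n r => rw [reflect, ofMonomials_C_mul_T]; simp

theorem mul_divDiffMonomial {p : ℂ} (hp : p ≠ 0) (n : ℤ) :
    (C p - T 2) * divDiffMonomial p n = T n - C (p ^ n) * T (-n) := by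
  have key : ∀ m : ℕ, (C p - T 2) * ∑ k ∈ Finset.range m, C (p ^ (m - 1 - k)) * T 2 ^ k =
      C (p ^ m) - (T (2 * m) : ℂ[T;T⁻¹]) := by
    intro m
    have h := (Commute.all (T 2 : ℂ[T;T⁻¹]) (C p)).mul_geom_sum₂ m
    have e : ∑ k ∈ Finset.range m, C (p ^ (m - 1 - k)) * T 2 ^ k =
        ∑ i ∈ Finset.range m, (T 2 : ℂ[T;T⁻¹]) ^ i * C p ^ (m - 1 - i) := by
      refine Finset.sum_congr rfl fun i _ => ?_
      rw [map_pow, mul_comm]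
    have e2 : (T (2 * m) : ℂ[T;T⁻¹]) = T 2 ^ m := by rw [T_pow, mul_comm]
    rw [e, e2, map_pow]
    linear_combination -h
  cases n with
  | ofNat n =>
    have h := key n
    have e : (T (n : ℤ) : ℂ[T;T⁻¹]) = T (-(n : ℤ)) * T (2 * n) := by
      rw [← T_add]; congr 1; ring
    simp only [divDiffMonomial, Int.ofNat_eq_natCast, zpow_natCast]
    rw [e]
    linear_combination (-T (-(n : ℤ))) * h
  | negSucc m =>
    have h := key (m + 1)
    have e : (T ((m : ℤ) + 1) : ℂ[T;T⁻¹]) = T (-((m : ℤ) + 1)) * T (2 * ((m + 1 : ℕ) : ℤ)) := by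
      rw [← T_add]; congr 1; push_cast; ring
    have e1 : (C ((p ^ (m + 1))⁻¹) * C (p ^ (m + 1)) : ℂ[T;T⁻¹]) = 1 := by
      rw [← map_mul, inv_mul_cancel₀ (pow_ne_zero _ hp), map_one]
    have e3 : Int.negSucc m = -((m : ℤ) + 1) := by omega
    simp only [divDiffMonomial, zpow_negSucc]
    rw [e3, neg_neg, e]
    simp only [Nat.add_sub_cancel] at h
    linear_combination (C ((p ^ (m + 1))⁻¹) * T (-((m : ℤ) + 1))) * h +
      T (-((m : ℤ) + 1)) * e1

/-- `divDiff` is the divided difference. -/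
theorem mul_divDiff {p : ℂ} (hp : p ≠ 0) (f : ℂ[T;T⁻¹]) :
    (C p - T 2) * divDiff p f = f - reflect p f := by
  induction f using LaurentPolynomial.induction_on' with
  | add f g hf hg => rw [map_add, map_add, mul_add, hf, hg]; ring
  | C_mul_T n r =>
    rw [reflect, divDiff, ofMonomials_C_mul_T, ofMonomials_C_mul_T]
    linear_combination C r * mul_divDiffMonomial hp n

/-- The operator of formula
`(T₁ f)[z] = ((a + b) z - (1 + ab)) / (1 - z²) f[z] + (1 - az) (1 - bz) / (1 - z²) f[z⁻¹]`,
written in the form `T₁ f = - ab f - (1 - az) (1 - bz) (f[z] - f[z⁻¹]) / (1 - z²)`;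
see `mul_opT1`. -/
def opT1 (a b : ℂ) : Module.End ℂ ℂ[T;T⁻¹] :=
  -(a * b) • (1 : Module.End ℂ ℂ[T;T⁻¹]) -
    LinearMap.mulLeft ℂ ((1 - C a * T 1) * (1 - C b * T 1)) * divDiff 1

/-- The operator of formula
`(T₀ f)[z] = q⁻¹ z ((cd + q) z - (c + d) q) / (q - z²) f[z] - (c - z) (d - z) / (q - z²) f[q z⁻¹]`,
written in the form `T₀ f = - q⁻¹ cd f + (c - z) (d - z) (f[z] - f[q z⁻¹]) / (q - z²)`;
see `mul_opT0`. -/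
def opT0 (q c d : ℂ) : Module.End ℂ ℂ[T;T⁻¹] :=
  -(q⁻¹ * c * d) • (1 : Module.End ℂ ℂ[T;T⁻¹]) +
    LinearMap.mulLeft ℂ ((C c - T 1) * (C d - T 1)) * divDiff q

theorem opT1_apply (a b : ℂ) (f : ℂ[T;T⁻¹]) : opT1 a b f =
    -(C a * C b) * f - (1 - C a * T 1) * (1 - C b * T 1) * divDiff 1 f := by
  simp [opT1, smul_eq_C_mul, mul_assoc]

theorem opT0_apply (q c d : ℂ) (f : ℂ[T;T⁻¹]) : opT0 q c d f =
    -(C q⁻¹ * C c * C d) * f + (C c - T 1) * (C d - T 1) * divDiff q f := by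
  simp [opT0, smul_eq_C_mul, mul_assoc]

theorem T_two : (T 2 : ℂ[T;T⁻¹]) = T 1 * T 1 := by rw [← T_add]; rfl

/-- The defining formula of `T₁`, cleared of its denominator. -/
theorem mul_opT1 (a b : ℂ) (f : ℂ[T;T⁻¹]) :
    (1 - T 2) * opT1 a b f =
      (C (a + b) * T 1 - C (1 + a * b)) * f +
        (1 - C a * T 1) * (1 - C b * T 1) * invert f := by
  have h := mul_divDiff one_ne_zero f
  rw [reflect_one_eq_invert, map_one] at h
  rw [opT1_apply]
  simp only [map_add, map_mul, map_one, T_two] at h ⊢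
  linear_combination -(1 - C a * T 1) * (1 - C b * T 1) * h

/-- The defining formula of `T₀`, cleared of its denominator. -/
theorem mul_opT0 {q : ℂ} (hq : q ≠ 0) (c d : ℂ) (f : ℂ[T;T⁻¹]) :
    (C q - T 2) * opT0 q c d f =
      C q⁻¹ * T 1 * (C (c * d + q) * T 1 - C ((c + d) * q)) * f -
        (C c - T 1) * (C d - T 1) * reflect q f := by
  have h := mul_divDiff hq f
  have e : (C q⁻¹ * C q : ℂ[T;T⁻¹]) = 1 := by rw [← map_mul, inv_mul_cancel₀ hq, map_one]
  rw [opT0_apply]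
  simp only [map_add, map_mul, T_two] at h ⊢
  linear_combination (C c - T 1) * (C d - T 1) * h +
    (-(C c * C d) + (C c + C d) * T 1 - T 1 * T 1) * f * e

theorem C_sub_T_two_ne_zero (p : ℂ) : (C p - T 2 : ℂ[T;T⁻¹]) ≠ 0 := by
  intro h
  have := congrArg (fun f : ℂ[T;T⁻¹] => f.coeff 2) h
  simp at this

theorem reflect_T_mul {p : ℂ} (hp : p ≠ 0) (m : ℤ) (f : ℂ[T;T⁻¹]) :
    reflect p (T m * f) = C (p ^ m) * T (-m) * reflect p f := by
  induction f using LaurentPolynomial.induction_on' with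
  | add f g hf hg => rw [mul_add, map_add, map_add, mul_add, hf, hg]
  | C_mul_T n r =>
    have e : (T m * (C r * T n) : ℂ[T;T⁻¹]) = C r * T (m + n) := by rw [T_add]; ring
    rw [e, reflect, ofMonomials_C_mul_T, ofMonomials_C_mul_T, zpow_add₀ hp, neg_add, T_add,
      map_mul]
    ring

theorem reflect_C_mul (p r : ℂ) (f : ℂ[T;T⁻¹]) : reflect p (C r * f) = C r * reflect p f := by
  rw [← smul_eq_C_mul, map_smul, smul_eq_C_mul]

theorem reflect_reflect {p : ℂ} (hp : p ≠ 0) (f : ℂ[T;T⁻¹]) : reflect p (reflect p f) = f := by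
  induction f using LaurentPolynomial.induction_on' with
  | add f g hf hg => rw [map_add, map_add, hf, hg]
  | C_mul_T n r =>
    rw [reflect_C_mul, reflect_T, reflect_C_mul, reflect_C_mul, reflect_T, ← mul_assoc (C (p ^ n)),
      ← map_mul, ← zpow_add₀ hp]
    simp

theorem C_mul_reflect_divDiff {p : ℂ} (hp : p ≠ 0) (f : ℂ[T;T⁻¹]) :
    C p * reflect p (divDiff p f) = T 2 * divDiff p f := by
  have h := mul_divDiff hp f
  have h' := congrArg (reflect p) h
  rw [sub_mul, map_sub, map_sub, reflect_reflect hp, reflect_C_mul, reflect_T_mul hp] at h'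
  have e : (T 2 * T (-2) : ℂ[T;T⁻¹]) = 1 := by rw [← T_add]; simp
  have e2 : (C (p ^ (2 : ℤ)) : ℂ[T;T⁻¹]) = C p * C p := by rw [← map_mul]; congr 1; norm_cast; ring
  rw [e2] at h'
  refine mul_left_cancel₀ (C_sub_T_two_ne_zero p) ?_
  linear_combination (-T 2) * h' - T 2 * h -
    C p * C p * reflect p (divDiff p f) * e

theorem reflect_quad {p : ℂ} (hp : p ≠ 0) (u v w : ℂ) (f : ℂ[T;T⁻¹]) :
    T 2 * reflect p ((C u + C v * T 1 + C w * T 2) * f) =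
      (C u * T 2 + C v * C p * T 1 + C w * C p * C p) * reflect p f := by
  have e1 : (T 1 * T (-1) : ℂ[T;T⁻¹]) = 1 := by rw [← T_add]; simp
  have e : (T 2 * T (-2) : ℂ[T;T⁻¹]) = 1 := by rw [← T_add]; simp
  have e2 : (C (p ^ (2 : ℤ)) : ℂ[T;T⁻¹]) = C p * C p := by rw [← map_mul]; congr 1; norm_cast; ring
  simp only [add_mul, map_add, mul_assoc, reflect_C_mul, reflect_T_mul hp, e2, zpow_one]
  rw [T_two] at e ⊢
  linear_combination C v * C p * T 1 * reflect p f * e1 + C w * C p * C p * reflect p f * e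

theorem divDiff_quad {p : ℂ} (hp : p ≠ 0) (u v w : ℂ) (f : ℂ[T;T⁻¹]) :
    C p * divDiff p ((C u + C v * T 1 + C w * T 2) * divDiff p f) =
      (C u - C p * C w) * divDiff p f := by
  have h := mul_divDiff hp ((C u + C v * T 1 + C w * T 2) * divDiff p f)
  have h1 := reflect_quad hp u v w (divDiff p f)
  have h2 := C_mul_reflect_divDiff hp f
  have e : (T 2 * T (-2) : ℂ[T;T⁻¹]) = 1 := by rw [← T_add]; simp
  have h3 : C p * reflect p ((C u + C v * T 1 + C w * T 2) * divDiff p f) =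
      (C u * T 2 + C v * C p * T 1 + C w * C p * C p) * divDiff p f := by
    linear_combination C p * T (-2) * h1 +
      T (-2) * (C u * T 2 + C v * C p * T 1 + C w * C p * C p) * h2 +
      ((C u * T 2 + C v * C p * T 1 + C w * C p * C p) * divDiff p f -
        C p * reflect p ((C u + C v * T 1 + C w * T 2) * divDiff p f)) * e
  refine mul_left_cancel₀ (C_sub_T_two_ne_zero p) ?_
  linear_combination C p * h - h3

theorem opT1_quadratic (a b : ℂ) (f : ℂ[T;T⁻¹]) :
    opT1 a b (opT1 a b f) = -(C a * C b + 1) * opT1 a b f - C a * C b * f := by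
  have h := divDiff_quad one_ne_zero 1 (-(a + b)) (a * b) f
  have e : ((1 - C a * T 1) * (1 - C b * T 1) : ℂ[T;T⁻¹]) =
      C 1 + C (-(a + b)) * T 1 + C (a * b) * T 2 := by
    simp only [map_add, map_mul, map_neg, map_one, T_two]; ring
  rw [opT1_apply a b (opT1 a b f)]
  rw [opT1_apply, e, map_sub]
  have h0 : divDiff 1 (-(C a * C b) * f) = -(C a * C b) * divDiff 1 f := by
    rw [← map_mul, ← map_neg, ← smul_eq_C_mul, map_smul, smul_eq_C_mul]
  rw [h0]
  simp only [map_add, map_mul, map_neg, map_one, one_mul] at h ⊢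
  rw [h]
  ring

theorem opT0_quadratic {q : ℂ} (hq : q ≠ 0) (c d : ℂ) (f : ℂ[T;T⁻¹]) :
    opT0 q c d (opT0 q c d f) =
      -(C q⁻¹ * C c * C d + 1) * opT0 q c d f - C q⁻¹ * C c * C d * f := by
  have h := divDiff_quad hq (c * d) (-(c + d)) 1 f
  have eq1 : (C q⁻¹ * C q : ℂ[T;T⁻¹]) = 1 := by rw [← map_mul, inv_mul_cancel₀ hq, map_one]
  have e : ((C c - T 1) * (C d - T 1) : ℂ[T;T⁻¹]) =
      C (c * d) + C (-(c + d)) * T 1 + C 1 * T 2 := by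
    simp only [map_add, map_mul, map_neg, map_one, T_two]; ring
  rw [opT0_apply q c d (opT0 q c d f)]
  rw [opT0_apply, e, map_add]
  have h0 : divDiff q (-(C q⁻¹ * C c * C d) * f) = -(C q⁻¹ * C c * C d) * divDiff q f := by
    rw [← map_mul, ← map_mul, ← map_neg, ← smul_eq_C_mul, map_smul, smul_eq_C_mul]
  have h' : divDiff q ((C (c * d) + C (-(c + d)) * T 1 + C 1 * T 2) * divDiff q f) =
      (C q⁻¹ * C c * C d - 1) * divDiff q f := by
    simp only [map_mul, map_one] at h ⊢
    linear_combination C q⁻¹ * h -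
      (divDiff q ((C c * C d + C (-(c + d)) * T 1 + 1 * T 2) * divDiff q f) +
        divDiff q f) * eq1
  rw [h0, h']
  ring

theorem isUnit_of_quadratic (A : Module.End ℂ ℂ[T;T⁻¹]) (s : ℂ) (hs : s ≠ 0)
    (h : ∀ f, A (A f) = -(C s + 1) * A f - C s * f) : IsUnit A := by
  have hA : A * A = -(s + 1) • A - s • 1 := by
    refine LinearMap.ext fun f => ?_
    simp only [smul_eq_C_mul, Module.End.mul_apply, LinearMap.sub_apply, LinearMap.smul_apply,
      Module.End.one_apply, h, map_neg, map_add, map_one]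
  have hs1 : -s⁻¹ * -s = 1 := by rw [neg_mul_neg, inv_mul_cancel₀ hs]
  have e : A * A + (s + 1) • A = (-s) • (1 : Module.End ℂ ℂ[T;T⁻¹]) := by
    rw [hA]; module
  have e1 : A * (-s⁻¹ • (A + (s + 1) • 1)) = 1 := by
    rw [mul_smul_comm, mul_add, mul_smul_comm, mul_one, e, smul_smul, hs1, one_smul]
  have e2 : (-s⁻¹ • (A + (s + 1) • 1)) * A = 1 := by
    rw [smul_mul_assoc, add_mul, smul_mul_assoc, one_mul, e, smul_smul, hs1, one_smul]
  exact ⟨⟨A, _, e1, e2⟩, rfl⟩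

theorem isUnit_opT1 {a b : ℂ} (ha : a ≠ 0) (hb : b ≠ 0) : IsUnit (opT1 a b) :=
  isUnit_of_quadratic _ (a * b) (mul_ne_zero ha hb) fun f => by
    simpa only [map_mul] using opT1_quadratic a b f

theorem isUnit_opT0 {q c d : ℂ} (hq : q ≠ 0) (hc : c ≠ 0) (hd : d ≠ 0) : IsUnit (opT0 q c d) :=
  isUnit_of_quadratic _ (q⁻¹ * c * d) (mul_ne_zero (mul_ne_zero (inv_ne_zero hq) hc) hd) fun f => by
    simpa only [map_mul] using opT0_quadratic hq c d f

/-- `Y = T₁ T₀`. -/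
def opY (q a b c d : ℂ) : Module.End ℂ ℂ[T;T⁻¹] :=
  opT1 a b * opT0 q c d

/-- `Y` is invertible, so `Ring.inverse` in `opD` is its genuine inverse. -/
theorem isUnit_opY {q a b c d : ℂ} (hq : q ≠ 0) (ha : a ≠ 0) (hb : b ≠ 0) (hc : c ≠ 0)
    (hd : d ≠ 0) : IsUnit (opY q a b c d) :=
  (isUnit_opT1 ha hb).mul (isUnit_opT0 hq hc hd)

/-- `D = Y + q⁻¹ abcd Y⁻¹`, acting on Laurent polynomials. -/
def opD (q a b c d : ℂ) : Module.End ℂ ℂ[T;T⁻¹] :=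
  opY q a b c d + (q⁻¹ * a * b * c * d) • Ring.inverse (opY q a b c d)

/-! ## Structure constants -/

section Constants

variable (q a b c d : ℂ)

def e1 : ℂ := a + b + c + d

def e2 : ℂ := a * b + a * c + b * c + a * d + b * d + c * d

def e3 : ℂ := a * b * c + a * b * d + a * c * d + b * c * d

def e4 : ℂ := a * b * c * d

def constB : ℂ := (1 - q⁻¹) ^ 2 * (e3 a b c d + q * e1 a b c d)

def constC0 : ℂ := (q - q⁻¹) ^ 2

def constC1 : ℂ := q⁻¹ * (q - q⁻¹) ^ 2 * e4 a b c d

def constD0 : ℂ :=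
  -(q⁻¹ ^ 3 * (1 - q) ^ 2 * (1 + q) * (e4 a b c d + q * e2 a b c d + q ^ 2))

def constD1 : ℂ :=
  -(q⁻¹ ^ 3 * (1 - q) ^ 2 * (1 + q) * (e1 a b c d * e4 a b c d + q * e3 a b c d))

def constE : ℂ := -(q⁻¹ ^ 2 * (1 - q) ^ 3 * (c + d))

def constF0 : ℂ := q⁻¹ ^ 3 * (1 - q) ^ 3 * (1 + q) * (c * d + q)

def constF1 : ℂ := q⁻¹ ^ 3 * (1 - q) ^ 3 * (1 + q) * (a + b) * c * d

def constG : ℂ :=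
  -(q⁻¹ ^ 4 * (1 - q) ^ 3 *
    ((a + b) * (c + d) * (c * d * (q ^ 2 + 1) + q)
      - q * (a * b + 1) * ((c ^ 2 + d ^ 2) * (q + 1) - c * d)
      + (c * d + e4 a b c d) * (q ^ 2 + 1)
      + (e2 a b c d + e4 a b c d - a * b) * q ^ 3))

def constQ0 : ℂ :=
  q⁻¹ ^ 4 * (1 - q) ^ 2 *
    (q ^ 4 * (e4 a b c d - e2 a b c d)
      + q ^ 3 * (e1 a b c d ^ 2 - e1 a b c d * e3 a b c d - 2 * e2 a b c d)
      - q ^ 2 * (e2 a b c d * e4 a b c d + 2 * e4 a b c d + e2 a b c d)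
      + q * (e3 a b c d ^ 2 - 2 * e2 a b c d * e4 a b c d - e1 a b c d * e3 a b c d)
      + e4 a b c d * (1 - e2 a b c d))

end Constants

/-! ## The algebra `AW(3,Q₀)~` by generators and relations -/

/-- The three generators. -/
inductive Gen
  | k0
  | k1
  | t1

/-- The generators in the free algebra. -/
def x0 : FreeAlgebra ℂ Gen := FreeAlgebra.ι ℂ Gen.k0

def x1 : FreeAlgebra ℂ Gen := FreeAlgebra.ι ℂ Gen.k1

def xt : FreeAlgebra ℂ Gen := FreeAlgebra.ι ℂ Gen.t1

/-- The element `T₁ + ab` of the free algebra. -/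
def xs (a b : ℂ) : FreeAlgebra ℂ Gen := xt + algebraMap ℂ _ (a * b)

/-- The Casimir element, in the free algebra. -/
def casimir (q a b c d : ℂ) : FreeAlgebra ℂ Gen :=
  (x1 * x0) ^ 2
    - (q ^ 2 + 1 + q⁻¹ ^ 2) • (x0 * (x1 * x0) * x1)
    + (q + q⁻¹) • (x0 ^ 2 * x1 ^ 2)
    + (q + q⁻¹) • (constC0 q • x0 ^ 2 + constC1 q a b c d • x1 ^ 2)
    + (algebraMap ℂ _ (constB q a b c d) + constE q c d • xs a b) *
        ((q + 1 + q⁻¹) • (x0 * x1) + x1 * x0)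
    + (q + 1 + q⁻¹) • ((algebraMap ℂ _ (constD0 q a b c d) + constF0 q c d • xs a b) * x0)
    + (q + 1 + q⁻¹) • ((algebraMap ℂ _ (constD1 q a b c d) + constF1 q a b c d • xs a b) * x1)
    + constG q a b c d • xs a b

/-- The defining relations. -/
inductive Rel (q a b c d : ℂ) : FreeAlgebra ℂ Gen → FreeAlgebra ℂ Gen → Prop
  | comm0 : Rel q a b c d (xt * x0) (x0 * xt)
  | comm1 : Rel q a b c d (xt * x1) (x1 * xt)
  | quad : Rel q a b c d ((xt + algebraMap ℂ _ (a * b)) * (xt + 1)) 0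
  | aw0 : Rel q a b c d
      ((q + q⁻¹) • (x1 * x0 * x1) - x1 ^ 2 * x0 - x0 * x1 ^ 2)
      (constB q a b c d • x1 + constC0 q • x0 + algebraMap ℂ _ (constD0 q a b c d)
        + constE q c d • (x1 * xs a b) + constF0 q c d • xs a b)
  | aw1 : Rel q a b c d
      ((q + q⁻¹) • (x0 * x1 * x0) - x0 ^ 2 * x1 - x1 * x0 ^ 2)
      (constB q a b c d • x0 + constC1 q a b c d • x1 + algebraMap ℂ _ (constD1 q a b c d)
        + constE q c d • (x0 * xs a b) + constF1 q a b c d • xs a b)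
  | casimir : Rel q a b c d (casimir q a b c d) (algebraMap ℂ _ (constQ0 q a b c d))

/-- The algebra `AW(3,Q₀)~` with generators `K₀`, `K₁`, `T₁`. -/
abbrev AWQ (q a b c d : ℂ) : Type := RingQuot (Rel q a b c d)

/-- The generator `K₀` of `AW(3,Q₀)~`. -/
def genK0 (q a b c d : ℂ) : AWQ q a b c d := RingQuot.mkAlgHom ℂ (Rel q a b c d) x0

/-- The generator `K₁` of `AW(3,Q₀)~`. -/
def genK1 (q a b c d : ℂ) : AWQ q a b c d := RingQuot.mkAlgHom ℂ (Rel q a b c d) x1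

/-- The generator `T₁` of `AW(3,Q₀)~`. -/
def genT1 (q a b c d : ℂ) : AWQ q a b c d := RingQuot.mkAlgHom ℂ (Rel q a b c d) xt

end

end Zhedanov

/-! Existence. On Laurent polynomials, multiplication by `z` and `z⁻¹` together with `T₁`, `T₀`
satisfies the double affine Hecke relations (`isHeckeModule_laurent`), and the quadratic relations
turn `Y + q⁻¹abcd Y⁻¹` into a polynomial in `T₁`, `T₀` (`opD_eq_heckeD`). The relations of
`AW(3,Q₀)~` can then be checked in any Hecke module: moving `Z` and `W = Z⁻¹` to the left of `T₁`
and `T₀` brings both sides to a common normal form, and comparing coefficients is arithmetic in `q,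
a, b, c, d` (`aw0`, `aw1`, `casimir`).

Spanning. `T₁` is central with a quadratic equation, and the other three relations are rewriting
rules for `K₁²K₀`, `K₁K₀²` and `(K₁K₀)²`. They show that the span of the monomials is stable under
left multiplication by the generators (`genK1_mul_pow_mul_mem`, `monomialSpan_eq_top`).

Faithfulness. Put `p = q⁻¹abcd`, `λ_n = q⁻ⁿ + p qⁿ` and `X = z + z⁻¹`. Modulo exponents of absolute
value below `n`, `D` acts on those of absolute value at most `n` as the scalar `λ_n`
(`heckeD_sub_mem_lowDeg`), while `X` raises the degree by one and keeps the leading coefficient. So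
`Dⁿ(XD)ⁱXᵐ` multiplies a leading coefficient in degree `e` by `λ_{e+m+i}ⁿ λ_{e+m}ⁱ`. A combination
killing every `Xᵏf` yields `P(λ_M) + R(λ_M) λ_{M-1} = 0` for infinitely many `M`. With `x = q^M`,
`λ_M` is invariant under `x ↦ (px)⁻¹` and `λ_{M-1}` is not, which forces `P = R = 0`
(`eq_zero_of_eval_eigen`, `linearIndependent_monomials`). Finally `A₀ + A₁(T₁ + ab)` is tested on
`1`, which `T₁ + ab` kills, and then on `z⁻¹` (`polyRep_injective`). -/

namespace Zhedanov

noncomputable section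

open LaurentPolynomial

/-! ## Modules over the double affine Hecke algebra of type `(C₁ᵛ, C₁)` -/

/-- Operators `Z`, `Z⁻¹ = W`, `T₁`, `T₀` satisfying the relations of the double affine Hecke
algebra. -/
structure IsHeckeModule {V : Type*} [AddCommGroup V] [Module ℂ V] (q a b c d : ℂ)
    (Z W T₁ T₀ : V →ₗ[ℂ] V) : Prop where
  ZW : ∀ x, Z (W x) = x
  WZ : ∀ x, W (Z x) = x
  quad₁ : ∀ x, T₁ (T₁ x) = -(a * b + 1) • T₁ x - (a * b) • x
  quad₀ : ∀ x, T₀ (T₀ x) = -(q⁻¹ * c * d + 1) • T₀ x - (q⁻¹ * c * d) • x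
  T₁Z : ∀ x, T₁ (Z x) = W (T₁ x) + (a * b + 1) • W x - (a + b) • x
  T₁W : ∀ x, T₁ (W x) = Z (T₁ x) - (a * b + 1) • W x + (a + b) • x
  T₀Z : ∀ x, T₀ (Z x) = q • W (T₀ x) - (q⁻¹ * c * d + 1) • Z x + (c + d) • x
  T₀W : ∀ x, T₀ (W x) =
    q⁻¹ • Z (T₀ x) + (q⁻¹ * (q⁻¹ * c * d + 1)) • Z x - (q⁻¹ * (c + d)) • x

/-- `T₁ T₀ + (q⁻¹ a b c d) (T₁ T₀)⁻¹`, with the inverse written out. -/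
def heckeD {V : Type*} [AddCommGroup V] [Module ℂ V] (q a b c d : ℂ) (T₁ T₀ : V →ₗ[ℂ] V) :
    V →ₗ[ℂ] V :=
  T₁ ∘ₗ T₀ + T₀ ∘ₗ T₁ + (a * b + 1) • T₀ + (q⁻¹ * c * d + 1) • T₁ +
    ((a * b + 1) * (q⁻¹ * c * d + 1)) • LinearMap.id

namespace IsHeckeModule

variable {V : Type*} [AddCommGroup V] [Module ℂ V] {q a b c d : ℂ} {Z W T₁ T₀ : V →ₗ[ℂ] V}

theorem heckeD_apply (x : V) : heckeD q a b c d T₁ T₀ x = T₁ (T₀ x) + T₀ (T₁ x) +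
    (a * b + 1) • T₀ x + (q⁻¹ * c * d + 1) • T₁ x +
    ((a * b + 1) * (q⁻¹ * c * d + 1)) • x := rfl

/-- By the quadratic relation, multiplying `T₁T₀ + T₀T₁ + (ab + 1)T₀` by `T₁` on either side leaves
`T₁T₀T₁ - ab T₀`. -/
theorem comm_heckeD (h : IsHeckeModule q a b c d Z W T₁ T₀) (x : V) :
    T₁ (heckeD q a b c d T₁ T₀ x) = heckeD q a b c d T₁ T₀ (T₁ x) := by
  simp only [heckeD_apply, map_add, map_sub, map_smul, h.quad₁]
  match_scalars <;> ring

theorem comm_add (h : IsHeckeModule q a b c d Z W T₁ T₀) (x : V) :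
    T₁ (Z x + W x) = Z (T₁ x) + W (T₁ x) := by
  simp only [map_add, h.T₁Z, h.T₁W]
  module

/-- Normal ordering: all `Z`, `W` stand to the left of all `T₁`, `T₀`. Every relation below is
verified by comparing coefficients in this form. -/
theorem heckeD_Z (h : IsHeckeModule q a b c d Z W T₁ T₀) (hq : q ≠ 0) (x : V) :
    heckeD q a b c d T₁ T₀ (Z x) = q • Z (T₁ (T₀ x)) + q⁻¹ • Z (T₀ (T₁ x)) +
      (q⁻¹ * (a * b + 1)) • Z (T₀ x) + (q⁻¹ * (q⁻¹ * c * d + 1)) • Z (T₁ x) +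
      (q⁻¹ * (a * b + 1) * (q⁻¹ * c * d + 1)) • Z x + ((q - 1) * (a + b)) • T₀ x +
      ((1 - q⁻¹) * (c + d)) • T₁ x + ((1 - q⁻¹) * (c + d) * (a * b + 1)) • x := by
  simp only [heckeD_apply, map_add, map_sub, map_smul, h.T₁Z, h.T₁W, h.T₀Z, h.T₀W]
  match_scalars <;> field_simp <;> ring

theorem heckeD_W (h : IsHeckeModule q a b c d Z W T₁ T₀) (hq : q ≠ 0) (x : V) :
    heckeD q a b c d T₁ T₀ (W x) = q⁻¹ • W (T₁ (T₀ x)) + q • W (T₀ (T₁ x)) +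
      (q⁻¹ * (a * b + 1)) • W (T₀ x) + (q⁻¹ * (q⁻¹ * c * d + 1)) • W (T₁ x) +
      (q⁻¹ * (a * b + 1) * (q⁻¹ * c * d + 1)) • W x + ((1 - q⁻¹) * (a + b)) • T₀ x +
      ((1 - q⁻¹) * (c + d)) • T₁ x + ((1 - q⁻¹) * (a + b) * (q⁻¹ * c * d + 1)) • x := by
  simp only [heckeD_apply, map_add, map_sub, map_smul, h.T₁Z, h.T₁W, h.T₀Z, h.T₀W]
  match_scalars <;> field_simp <;> ring

/-- Only the Casimir element needs `D` moved past squares of `Z` and `W`; having these expansions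
ready keeps its normal form manageable. -/
theorem heckeD_Z_Z (h : IsHeckeModule q a b c d Z W T₁ T₀) (hq : q ≠ 0) (x : V) :
    heckeD q a b c d T₁ T₀ (Z (Z x)) = q ^ 2 • Z (Z (T₁ (T₀ x))) + q⁻¹ ^ 2 • Z (Z (T₀ (T₁ x))) +
      (q⁻¹ ^ 2 * (a * b + 1)) • Z (Z (T₀ x)) + (q⁻¹ ^ 2 * (q⁻¹ * c * d + 1)) • Z (Z (T₁ x)) +
      (q⁻¹ ^ 2 * (a * b + 1) * (q⁻¹ * c * d + 1)) • Z (Z x) +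
      ((q ^ 2 - q⁻¹) * (a + b)) • Z (T₀ x) + ((q - q⁻¹ ^ 2) * (c + d)) • Z (T₁ x) +
      ((1 - q⁻¹) * (a + b) * (q⁻¹ * c * d + 1) +
        (1 - q⁻¹ ^ 2) * (c + d) * (a * b + 1)) • Z x +
      ((1 - q ^ 2) * (a * b + 1)) • T₀ x + ((q⁻¹ - q) * (q⁻¹ * c * d + 1)) • T₁ x +
      ((q - 2 + q⁻¹) * (a + b) * (c + d) +
        (q⁻¹ - q) * (a * b + 1) * (q⁻¹ * c * d + 1)) • x +
      ((q ^ 2 - q) * (a + b)) • W (T₀ x) + ((1 - q⁻¹) * (c + d)) • W (T₁ x) +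
      ((1 - q⁻¹) * (c + d) * (a * b + 1)) • W x := by
  simp only [h.heckeD_Z hq, map_add, map_sub, map_smul, h.T₁Z, h.T₁W, h.T₀Z, h.T₀W, h.ZW]
  match_scalars <;> field_simp <;> ring

theorem heckeD_W_W (h : IsHeckeModule q a b c d Z W T₁ T₀) (hq : q ≠ 0) (x : V) :
    heckeD q a b c d T₁ T₀ (W (W x)) = q⁻¹ ^ 2 • W (W (T₁ (T₀ x))) + q ^ 2 • W (W (T₀ (T₁ x))) +
      (q⁻¹ ^ 2 * (a * b + 1)) • W (W (T₀ x)) + (q⁻¹ ^ 2 * (q⁻¹ * c * d + 1)) • W (W (T₁ x)) +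
      (q⁻¹ ^ 2 * (a * b + 1) * (q⁻¹ * c * d + 1)) • W (W x) +
      ((q - q⁻¹ ^ 2) * (a + b)) • W (T₀ x) + ((q - q⁻¹ ^ 2) * (c + d)) • W (T₁ x) +
      ((1 - q⁻¹ ^ 2) * (a + b) * (q⁻¹ * c * d + 1) +
        (q⁻¹ - q⁻¹ ^ 2) * (c + d) * (a * b + 1)) • W x +
      ((q⁻¹ ^ 2 - 1) * (a * b + 1)) • T₀ x + ((q⁻¹ - q) * (q⁻¹ * c * d + 1)) • T₁ x +
      ((1 - q⁻¹) ^ 2 * (a + b) * (c + d) +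
        (q⁻¹ ^ 2 - 1) * (a * b + 1) * (q⁻¹ * c * d + 1)) • x +
      ((q⁻¹ - q⁻¹ ^ 2) * (a + b)) • Z (T₀ x) + ((1 - q⁻¹) * (c + d)) • Z (T₁ x) +
      ((q⁻¹ - q⁻¹ ^ 2) * (a + b) * (q⁻¹ * c * d + 1)) • Z x := by
  simp only [h.heckeD_W hq, map_add, map_sub, map_smul, h.T₁Z, h.T₁W, h.T₀Z, h.T₀W, h.WZ]
  match_scalars <;> field_simp <;> ring

theorem heckeD_add (h : IsHeckeModule q a b c d Z W T₁ T₀) (hq : q ≠ 0) (x : V) :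
    heckeD q a b c d T₁ T₀ (Z x + W x) = q • Z (T₁ (T₀ x)) + q⁻¹ • Z (T₀ (T₁ x)) +
      (q⁻¹ * (a * b + 1)) • Z (T₀ x) + (q⁻¹ * (q⁻¹ * c * d + 1)) • Z (T₁ x) +
      (q⁻¹ * (a * b + 1) * (q⁻¹ * c * d + 1)) • Z x + ((q - q⁻¹) * (a + b)) • T₀ x +
      (2 * (1 - q⁻¹) * (c + d)) • T₁ x +
      ((1 - q⁻¹) * ((c + d) * (a * b + 1) + (a + b) * (q⁻¹ * c * d + 1))) • x +
      q⁻¹ • W (T₁ (T₀ x)) + q • W (T₀ (T₁ x)) +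
      (q⁻¹ * (a * b + 1)) • W (T₀ x) + (q⁻¹ * (q⁻¹ * c * d + 1)) • W (T₁ x) +
      (q⁻¹ * (a * b + 1) * (q⁻¹ * c * d + 1)) • W x := by
  rw [map_add, h.heckeD_Z hq, h.heckeD_W hq]
  module

/-- First Askey–Wilson relation. -/
theorem aw0 (h : IsHeckeModule q a b c d Z W T₁ T₀) (hq : q ≠ 0) {X D S : V →ₗ[ℂ] V}
    (hX : ∀ x, X x = Z x + W x) (hD : D = heckeD q a b c d T₁ T₀)
    (hS : ∀ x, S x = T₁ x + (a * b) • x) (x : V) :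
    (q + q⁻¹) • X (D (X x)) - X (X (D x)) - D (X (X x)) =
      constB q a b c d • X x + constC0 q • D x + constD0 q a b c d • x +
        constE q c d • X (S x) + constF0 q c d • S x := by
  subst hD
  simp only [hX, hS, map_add, map_smul, h.heckeD_Z hq, h.heckeD_W hq]
  simp only [heckeD_apply, map_add, map_sub, map_smul, h.T₁Z, h.T₁W, h.T₀Z, h.T₀W, h.ZW, h.WZ,
    constB, constC0, constD0, constE, constF0, e1, e2, e3, e4]
  match_scalars <;> field_simp <;> ring

/-- Second Askey–Wilson relation. -/
theorem aw1 (h : IsHeckeModule q a b c d Z W T₁ T₀) (hq : q ≠ 0) {X D S : V →ₗ[ℂ] V}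
    (hX : ∀ x, X x = Z x + W x) (hD : D = heckeD q a b c d T₁ T₀)
    (hS : ∀ x, S x = T₁ x + (a * b) • x) (x : V) :
    (q + q⁻¹) • D (X (D x)) - D (D (X x)) - X (D (D x)) =
      constB q a b c d • D x + constC1 q a b c d • X x + constD1 q a b c d • x +
        constE q c d • D (S x) + constF1 q a b c d • S x := by
  subst hD
  simp only [hX, hS, map_add, map_smul, h.heckeD_Z hq, h.heckeD_W hq]
  simp only [heckeD_apply, map_add, map_sub, map_smul, h.quad₁, h.quad₀,
    constB, constC1, constD1, constE, constF1, e1, e3, e4]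
  match_scalars <;> field_simp <;> ring

set_option maxHeartbeats 4000000 in
/-- The Casimir element acts as the scalar `Q₀`. -/
theorem casimir (h : IsHeckeModule q a b c d Z W T₁ T₀) (hq : q ≠ 0) {X D S : V →ₗ[ℂ] V}
    (hX : ∀ x, X x = Z x + W x) (hD : D = heckeD q a b c d T₁ T₀)
    (hS : ∀ x, S x = T₁ x + (a * b) • x) (x : V) :
    X (D (X (D x))) - (q ^ 2 + 1 + q⁻¹ ^ 2) • D (X (D (X x))) + (q + q⁻¹) • D (D (X (X x))) +
      (q + q⁻¹) • (constC0 q • D (D x) + constC1 q a b c d • X (X x)) +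
      (constB q a b c d • ((q + 1 + q⁻¹) • D (X x) + X (D x)) +
        constE q c d • S ((q + 1 + q⁻¹) • D (X x) + X (D x))) +
      (q + 1 + q⁻¹) • (constD0 q a b c d • D x + constF0 q c d • S (D x)) +
      (q + 1 + q⁻¹) • (constD1 q a b c d • X x + constF1 q a b c d • S (X x)) +
      constG q a b c d • S x = constQ0 q a b c d • x := by
  have e := h.aw1 hq hX hD hS (X x)
  -- The second Askey–Wilson relation at `X x` trades `D²X²` for `DXDX` and `XD²X`, whose common
  -- inner factor `D (X x)` is expanded once and for all by `hDX`.
  have e' : D (D (X (X x))) = (q + q⁻¹) • D (X (D (X x))) - X (D (D (X x))) -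
      (constB q a b c d • D (X x) + constC1 q a b c d • X (X x) + constD1 q a b c d • X x +
        constE q c d • D (S (X x)) + constF1 q a b c d • S (X x)) := by
    rw [← e]; abel
  have hDX := h.heckeD_add hq x
  rw [← hX, ← hD] at hDX
  have hSX : ∀ y, S (X y) = X (S y) := fun y => by
    simp only [hS, hX, map_add, map_smul, smul_add]
    have := h.comm_add y
    rw [map_add] at this
    rw [← add_assoc, this]
    abel
  rw [e']
  simp only [hSX, hDX, map_add, map_smul]
  subst hD
  simp only [hX, hS, map_add, map_smul]
  simp only [h.heckeD_Z_Z hq, h.heckeD_W_W hq, h.ZW, h.WZ]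
  simp only [h.heckeD_Z hq, h.heckeD_W hq]
  simp only [heckeD_apply, map_add, map_sub, map_smul, h.ZW, h.WZ, h.quad₁, h.quad₀,
    h.T₁Z, h.T₁W, constB,
    constC0, constC1, constD0, constD1, constE, constF0, constF1, constG, constQ0, e1, e2, e3, e4]
  match_scalars <;> field_simp <;> ring

end IsHeckeModule

/-! ## The polynomial representation -/

theorem T_one_mul_T_neg_one : (T 1 * T (-1) : ℂ[T;T⁻¹]) = 1 := by rw [← T_add]; simp

/-- Twisted Leibniz rule for the divided difference; this and its companion for `z⁻¹` give all the
cross relations between `Z`, `W` and `T₁`, `T₀`. -/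
theorem divDiff_T_one_mul {p : ℂ} (hp : p ≠ 0) (f : ℂ[T;T⁻¹]) :
    divDiff p (T 1 * f) = C p * T (-1) * divDiff p f - T (-1) * f := by
  have h := mul_divDiff hp (T 1 * f)
  have h' := mul_divDiff hp f
  rw [reflect_T_mul hp, zpow_one] at h
  refine mul_left_cancel₀ (C_sub_T_two_ne_zero p) ?_
  rw [T_two] at *
  linear_combination h - C p * T (-1) * h' - T 1 * f * T_one_mul_T_neg_one

theorem divDiff_T_neg_one_mul {p : ℂ} (hp : p ≠ 0) (f : ℂ[T;T⁻¹]) :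
    divDiff p (T (-1) * f) = C p⁻¹ * (T 1 * divDiff p f + T (-1) * f) := by
  have h := mul_divDiff hp (T (-1) * f)
  have h' := mul_divDiff hp f
  have e : (C p⁻¹ * C p : ℂ[T;T⁻¹]) = 1 := by rw [← map_mul, inv_mul_cancel₀ hp, map_one]
  rw [reflect_T_mul hp, zpow_neg_one, neg_neg] at h
  refine mul_left_cancel₀ (C_sub_T_two_ne_zero p) ?_
  rw [T_two] at *
  linear_combination h - C p⁻¹ * T 1 * h' - T (-1) * f * e +
    C p⁻¹ * T 1 * f * T_one_mul_T_neg_one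

theorem isHeckeModule_laurent {q : ℂ} (hq : q ≠ 0) (a b c d : ℂ) :
    IsHeckeModule q a b c d (LinearMap.mulLeft ℂ (T 1 : ℂ[T;T⁻¹])) (LinearMap.mulLeft ℂ (T (-1)))
      (opT1 a b) (opT0 q c d) := by
  have e := T_one_mul_T_neg_one
  have eq1 : (C q⁻¹ * C q : ℂ[T;T⁻¹]) = 1 := by rw [← map_mul, inv_mul_cancel₀ hq, map_one]
  constructor <;> intro x <;> simp only [LinearMap.mulLeft_apply, smul_eq_C_mul]
  · linear_combination x * e
  · linear_combination x * e
  · rw [opT1_quadratic]; simp only [map_add, map_mul, map_neg, map_one]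
  · rw [opT0_quadratic hq]; simp only [map_add, map_mul, map_neg, map_one]
  · simp only [opT1_apply, divDiff_T_one_mul one_ne_zero, map_add, map_mul, map_one]
    linear_combination (C a * C b * T 1 * x - (C a + C b) * x) * e
  · simp only [opT1_apply, divDiff_T_neg_one_mul one_ne_zero, map_add, map_mul, map_one, inv_one]
    linear_combination (C a + C b - C a * C b * T 1) * x * e
  · simp only [opT0_apply, divDiff_T_one_mul hq, map_add, map_mul, map_one]
    linear_combination ((C c + C d - T 1) * x) * e + C c * C d * T (-1) * x * eq1
  · simp only [opT0_apply, divDiff_T_neg_one_mul hq, map_add, map_mul, map_one]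
    linear_combination (C q⁻¹ * (T 1 - (C c + C d)) * x) * e

theorem opD_eq_heckeD {q a b c d : ℂ} (hq : q ≠ 0) (ha : a ≠ 0) (hb : b ≠ 0) (hc : c ≠ 0)
    (hd : d ≠ 0) : opD q a b c d = heckeD q a b c d (opT1 a b) (opT0 q c d) := by
  have h := isHeckeModule_laurent hq a b c d
  -- The quadratic relations give `-ab T₁⁻¹ = T₁ + ab + 1` and `-q⁻¹cd T₀⁻¹ = T₀ + q⁻¹cd + 1`, so
  -- `N` is `q⁻¹abcd Y⁻¹`.
  set N : Module.End ℂ ℂ[T;T⁻¹] :=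
    (opT0 q c d + (q⁻¹ * c * d + 1) • 1) * (opT1 a b + (a * b + 1) • 1) with hN
  have hY : opY q a b c d * N = (q⁻¹ * a * b * c * d) • 1 := by
    refine LinearMap.ext fun x => ?_
    simp only [hN, opY, Module.End.mul_apply, LinearMap.add_apply, LinearMap.smul_apply,
      Module.End.one_apply, map_add, map_smul, h.quad₀, h.quad₁, map_sub]
    match_scalars <;> ring
  have hI : (q⁻¹ * a * b * c * d) • Ring.inverse (opY q a b c d) = N := by
    rw [← mul_one (Ring.inverse _), ← mul_smul_comm, ← hY, ← mul_assoc,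
      Ring.inverse_mul_cancel _ (isUnit_opY hq ha hb hc hd), one_mul]
  rw [opD, hI]
  refine LinearMap.ext fun x => ?_
  simp only [hN, opY, Module.End.mul_apply, LinearMap.add_apply, LinearMap.smul_apply,
      Module.End.one_apply, map_add, map_smul, heckeD, LinearMap.comp_apply, LinearMap.id_apply]
  module

/-- Multiplication by `z + z⁻¹`. -/
def opX : Module.End ℂ ℂ[T;T⁻¹] := LinearMap.mulLeft ℂ (T 1 + T (-1))

/-- The images of the generators. -/
def genImage (q a b c d : ℂ) : Gen → Module.End ℂ ℂ[T;T⁻¹]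
  | Gen.k0 => opD q a b c d
  | Gen.k1 => opX
  | Gen.t1 => opT1 a b

theorem opX_apply (f : ℂ[T;T⁻¹]) :
    opX f = LinearMap.mulLeft ℂ (T 1) f + LinearMap.mulLeft ℂ (T (-1)) f := by
  simp [opX, add_mul]

theorem lift_genImage_rel {q a b c d : ℂ} (hq : q ≠ 0) (ha : a ≠ 0) (hb : b ≠ 0) (hc : c ≠ 0)
    (hd : d ≠ 0) ⦃u v : FreeAlgebra ℂ Gen⦄ (h : Rel q a b c d u v) :
    FreeAlgebra.lift ℂ (genImage q a b c d) u = FreeAlgebra.lift ℂ (genImage q a b c d) v := by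
  have H := isHeckeModule_laurent hq a b c d
  have hD := opD_eq_heckeD hq ha hb hc hd
  obtain ⟨S, S_eq⟩ : ∃ S, S = opT1 a b + algebraMap ℂ (Module.End ℂ ℂ[T;T⁻¹]) (a * b) := ⟨_, rfl⟩
  have hS : ∀ x, S x = opT1 a b x + (a * b) • x := fun x => by
    rw [S_eq, LinearMap.add_apply, Module.algebraMap_end_apply]
  have l0 : FreeAlgebra.lift ℂ (genImage q a b c d) x0 = opD q a b c d := by
    simp [x0, genImage]
  have l1 : FreeAlgebra.lift ℂ (genImage q a b c d) x1 = opX := by simp [x1, genImage]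
  have lt : FreeAlgebra.lift ℂ (genImage q a b c d) xt = opT1 a b := by simp [xt, genImage]
  have ls : FreeAlgebra.lift ℂ (genImage q a b c d) (xs a b) = S := by
    rw [xs, map_add, lt, AlgHom.commutes, S_eq]
  refine LinearMap.ext fun x => ?_
  cases h with
  | comm0 =>
    rw [map_mul, map_mul, lt, l0, hD]
    exact H.comm_heckeD x
  | comm1 =>
    rw [map_mul, map_mul, lt, l1, Module.End.mul_apply, Module.End.mul_apply, opX_apply,
      opX_apply]
    exact H.comm_add x
  | quad =>
    simp only [map_mul, map_add, map_one, map_zero, AlgHom.commutes, lt, Module.End.mul_apply,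
      LinearMap.add_apply, Module.End.one_apply, Module.algebraMap_end_apply, H.quad₁,
      LinearMap.zero_apply]
    module
  | aw0 =>
    simp only [map_sub, map_mul, map_add, map_smul, AlgHom.commutes, l0, l1, ls, pow_two,
      Module.End.mul_apply, LinearMap.add_apply, LinearMap.sub_apply, LinearMap.smul_apply,
      Module.algebraMap_end_apply]
    exact H.aw0 hq opX_apply hD hS x
  | aw1 =>
    simp only [map_sub, map_mul, map_add, map_smul, AlgHom.commutes, l0, l1, ls, pow_two,
      Module.End.mul_apply, LinearMap.add_apply, LinearMap.sub_apply, LinearMap.smul_apply,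
      Module.algebraMap_end_apply]
    exact H.aw1 hq opX_apply hD hS x
  | casimir =>
    rw [AlgHom.commutes, Module.algebraMap_end_apply, ← H.casimir hq opX_apply hD hS x]
    simp only [casimir, map_sub, map_mul, map_add, map_smul, map_pow, AlgHom.commutes, l0, l1, ls,
      Module.End.mul_apply, LinearMap.add_apply, LinearMap.sub_apply, LinearMap.smul_apply,
      Module.algebraMap_end_apply, pow_two (opX * opD q a b c d), pow_two opX,
      pow_two (opD q a b c d)]
    module

/-- The representation of `AW(3,Q₀)~` on Laurent polynomials. -/
def polyRep {q a b c d : ℂ} (hq : q ≠ 0) (ha : a ≠ 0) (hb : b ≠ 0) (hc : c ≠ 0) (hd : d ≠ 0) :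
    AWQ q a b c d →ₐ[ℂ] Module.End ℂ ℂ[T;T⁻¹] :=
  RingQuot.liftAlgHom ℂ ⟨FreeAlgebra.lift ℂ (genImage q a b c d),
    lift_genImage_rel hq ha hb hc hd⟩

section

variable {q a b c d : ℂ} (hq : q ≠ 0) (ha : a ≠ 0) (hb : b ≠ 0) (hc : c ≠ 0) (hd : d ≠ 0)

theorem polyRep_genK0 : polyRep hq ha hb hc hd (genK0 q a b c d) = opD q a b c d := by
  simp [polyRep, genK0, x0, genImage]

theorem polyRep_genK1 : polyRep hq ha hb hc hd (genK1 q a b c d) = opX := by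
  simp [polyRep, genK1, x1, genImage]

theorem polyRep_genT1 : polyRep hq ha hb hc hd (genT1 q a b c d) = opT1 a b := by
  simp [polyRep, genT1, xt, genImage]

end

/-! ## The spanning set of `AW(3,Q₀)~` -/

section Span

variable (q a b c d : ℂ)

/-- The element `T₁ + ab` of `AW(3,Q₀)~`. -/
def genS : AWQ q a b c d := genT1 q a b c d + algebraMap ℂ _ (a * b)

theorem mkAlgHom_x0 : RingQuot.mkAlgHom ℂ (Rel q a b c d) x0 = genK0 q a b c d := rfl

theorem mkAlgHom_x1 : RingQuot.mkAlgHom ℂ (Rel q a b c d) x1 = genK1 q a b c d := rfl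

theorem mkAlgHom_xt : RingQuot.mkAlgHom ℂ (Rel q a b c d) xt = genT1 q a b c d := rfl

theorem mkAlgHom_xs : RingQuot.mkAlgHom ℂ (Rel q a b c d) (xs a b) = genS q a b c d := by
  rw [xs, map_add, AlgHom.commutes, mkAlgHom_xt, genS]

theorem commute_genT1_genK0 : Commute (genT1 q a b c d) (genK0 q a b c d) := by
  have h := RingQuot.mkAlgHom_rel ℂ (Rel.comm0 (q := q) (a := a) (b := b) (c := c) (d := d))
  rwa [map_mul, map_mul] at h

theorem commute_genT1_genK1 : Commute (genT1 q a b c d) (genK1 q a b c d) := by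
  have h := RingQuot.mkAlgHom_rel ℂ (Rel.comm1 (q := q) (a := a) (b := b) (c := c) (d := d))
  rwa [map_mul, map_mul] at h

theorem genT1_sq : genT1 q a b c d * genT1 q a b c d =
    -(a * b + 1) • genT1 q a b c d - (a * b) • 1 := by
  have h := RingQuot.mkAlgHom_rel ℂ (Rel.quad (q := q) (a := a) (b := b) (c := c) (d := d))
  rw [map_mul, map_add, map_add, AlgHom.commutes, mkAlgHom_xt, map_one, map_zero,
    Algebra.algebraMap_eq_smul_one, add_mul, mul_add, mul_add, smul_mul_assoc, mul_one, mul_one,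
    one_mul] at h
  rw [← sub_eq_zero, ← h]
  module

theorem genK1_sq_mul_genK0 : genK1 q a b c d * genK1 q a b c d * genK0 q a b c d =
    (q + q⁻¹) • (genK1 q a b c d * genK0 q a b c d * genK1 q a b c d) -
      genK0 q a b c d * genK1 q a b c d * genK1 q a b c d -
      (constB q a b c d • genK1 q a b c d + constC0 q • genK0 q a b c d +
        constD0 q a b c d • 1 + constE q c d • (genK1 q a b c d * genS q a b c d) +
        constF0 q c d • genS q a b c d) := by
  have h := RingQuot.mkAlgHom_rel ℂ (Rel.aw0 (q := q) (a := a) (b := b) (c := c) (d := d))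
  simp only [map_mul, map_add, map_sub, map_smul, map_one, mkAlgHom_x0, mkAlgHom_x1,
    mkAlgHom_xs, pow_two, Algebra.algebraMap_eq_smul_one] at h
  rw [← h, mul_assoc (genK0 q a b c d)]
  abel

theorem genK1_mul_genK0_sq : genK1 q a b c d * genK0 q a b c d * genK0 q a b c d =
    (q + q⁻¹) • (genK0 q a b c d * genK1 q a b c d * genK0 q a b c d) -
      genK0 q a b c d * genK0 q a b c d * genK1 q a b c d -
      (constB q a b c d • genK0 q a b c d + constC1 q a b c d • genK1 q a b c d +
        constD1 q a b c d • 1 + constE q c d • (genK0 q a b c d * genS q a b c d) +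
        constF1 q a b c d • genS q a b c d) := by
  have h := RingQuot.mkAlgHom_rel ℂ (Rel.aw1 (q := q) (a := a) (b := b) (c := c) (d := d))
  simp only [map_mul, map_add, map_sub, map_smul, map_one, mkAlgHom_x0, mkAlgHom_x1,
    mkAlgHom_xs, pow_two, Algebra.algebraMap_eq_smul_one] at h
  rw [← h, mul_assoc (genK1 q a b c d)]
  abel

/-- The Casimir relation solved for `(K₁K₀)²`: this is why the exponent `i` of the spanning
monomials stops at `1`. -/
theorem genK1_mul_genK0_mul_self :
    genK1 q a b c d * genK0 q a b c d * (genK1 q a b c d * genK0 q a b c d) =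
      constQ0 q a b c d • 1 + (q ^ 2 + 1 + q⁻¹ ^ 2) •
        (genK0 q a b c d * (genK1 q a b c d * genK0 q a b c d) * genK1 q a b c d) -
      ((q + q⁻¹) • (genK0 q a b c d * genK0 q a b c d * (genK1 q a b c d * genK1 q a b c d)) +
        (q + q⁻¹) • (constC0 q • (genK0 q a b c d * genK0 q a b c d) +
          constC1 q a b c d • (genK1 q a b c d * genK1 q a b c d)) +
        (constB q a b c d • 1 + constE q c d • genS q a b c d) *
          ((q + 1 + q⁻¹) • (genK0 q a b c d * genK1 q a b c d) +
            genK1 q a b c d * genK0 q a b c d) +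
        (q + 1 + q⁻¹) • ((constD0 q a b c d • 1 + constF0 q c d • genS q a b c d) *
          genK0 q a b c d) +
        (q + 1 + q⁻¹) • ((constD1 q a b c d • 1 + constF1 q a b c d • genS q a b c d) *
          genK1 q a b c d) +
        constG q a b c d • genS q a b c d) := by
  have h := RingQuot.mkAlgHom_rel ℂ (Rel.casimir (q := q) (a := a) (b := b) (c := c) (d := d))
  simp only [casimir, map_mul, map_add, map_sub, map_smul, map_one, mkAlgHom_x0,
    mkAlgHom_x1, mkAlgHom_xs, pow_two (x1 * x0), pow_two x0, pow_two x1,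
    Algebra.algebraMap_eq_smul_one] at h
  rw [← h]
  abel

/-- The spanning monomials. -/
def monomialAW (n i m j : ℕ) : AWQ q a b c d :=
  genK0 q a b c d ^ n * (genK1 q a b c d * genK0 q a b c d) ^ i * genK1 q a b c d ^ m *
    genT1 q a b c d ^ j

/-- The span of the monomials with `i, j ∈ {0, 1}`. -/
def monomialSpan : Submodule ℂ (AWQ q a b c d) :=
  Submodule.span ℂ (Set.range fun x : ℕ × Fin 2 × ℕ × Fin 2 =>
    monomialAW q a b c d x.1 x.2.1 x.2.2.1 x.2.2.2)

variable {q a b c d}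

theorem monomialAW_mem {n i m j : ℕ} (hi : i < 2) (hj : j < 2) :
    monomialAW q a b c d n i m j ∈ monomialSpan q a b c d :=
  Submodule.subset_span ⟨(n, ⟨i, hi⟩, m, ⟨j, hj⟩), rfl⟩

theorem mul_mem_monomialSpan {r v : AWQ q a b c d}
    (h : ∀ (n m : ℕ) (i j : Fin 2), r * monomialAW q a b c d n i m j ∈ monomialSpan q a b c d)
    (hv : v ∈ monomialSpan q a b c d) : r * v ∈ monomialSpan q a b c d := by
  have : monomialSpan q a b c d ≤ (monomialSpan q a b c d).comap (LinearMap.mulLeft ℂ r) := by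
    refine Submodule.span_le.2 ?_
    rintro _ ⟨x, rfl⟩
    exact h _ _ _ _
  exact this hv

theorem genK0_mul_mem {v : AWQ q a b c d} (hv : v ∈ monomialSpan q a b c d) :
    genK0 q a b c d * v ∈ monomialSpan q a b c d := by
  refine mul_mem_monomialSpan (fun n m i j => ?_) hv
  have : genK0 q a b c d * monomialAW q a b c d n i m j = monomialAW q a b c d (n + 1) i m j := by
    simp only [monomialAW, pow_succ' _ n, mul_assoc]
  rw [this]
  exact monomialAW_mem i.2 j.2

theorem commute_genT1_monomialAW (n i m j : ℕ) :
    Commute (genT1 q a b c d) (monomialAW q a b c d n i m j) := by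
  have h0 := commute_genT1_genK0 q a b c d
  have h1 := commute_genT1_genK1 q a b c d
  exact ((((h0.pow_right n).mul_right ((h1.mul_right h0).pow_right i)).mul_right
    (h1.pow_right m)).mul_right ((Commute.refl _).pow_right j))

theorem genT1_mul_mem {v : AWQ q a b c d} (hv : v ∈ monomialSpan q a b c d) :
    genT1 q a b c d * v ∈ monomialSpan q a b c d := by
  refine mul_mem_monomialSpan (fun n m i j => ?_) hv
  rw [(commute_genT1_monomialAW n i m j).eq]
  fin_cases j
  · have : monomialAW q a b c d n i m 0 * genT1 q a b c d = monomialAW q a b c d n i m 1 := by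
      simp [monomialAW]
    simpa only [this] using monomialAW_mem i.2 one_lt_two
  · have : monomialAW q a b c d n i m 1 * genT1 q a b c d =
        -(a * b + 1) • monomialAW q a b c d n i m 1 - (a * b) • monomialAW q a b c d n i m 0 := by
      simp only [monomialAW, pow_one, pow_zero, mul_one]
      rw [mul_assoc _ (genT1 q a b c d), genT1_sq, mul_sub, mul_smul_comm, mul_smul_comm, mul_one]
    simp only [this]
    exact sub_mem (Submodule.smul_mem _ _ (monomialAW_mem i.2 one_lt_two))
      (Submodule.smul_mem _ _ (monomialAW_mem i.2 two_pos))

theorem genS_mul_mem {v : AWQ q a b c d} (hv : v ∈ monomialSpan q a b c d) :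
    genS q a b c d * v ∈ monomialSpan q a b c d := by
  rw [genS, add_mul, Algebra.algebraMap_eq_smul_one, smul_mul_assoc, one_mul]
  exact add_mem (genT1_mul_mem hv) (Submodule.smul_mem _ _ hv)

theorem commute_genS_genK1 : Commute (genS q a b c d) (genK1 q a b c d) :=
  (commute_genT1_genK1 q a b c d).add_left (Algebra.commutes _ _)

theorem mul_pow_mul_mem {n i m : ℕ} (hi : i < 2) :
    genK0 q a b c d ^ n * ((genK1 q a b c d * genK0 q a b c d) ^ i * genK1 q a b c d ^ m) ∈
      monomialSpan q a b c d := by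
  have := monomialAW_mem (q := q) (a := a) (b := b) (c := c) (d := d) (n := n) (m := m) hi two_pos
  simpa only [monomialAW, pow_zero, mul_one, mul_assoc] using this

/-- Moving `K₁` to the right through `K₀ⁿ` is the only nontrivial closure property. The cases `n =
0`, `n = 1`, `n ≥ 2` use the first Askey–Wilson relation, the Casimir relation and the second
Askey–Wilson relation respectively. -/
theorem genK1_mul_pow_mul_mem (n m : ℕ) (i : Fin 2) :
    genK1 q a b c d * (genK0 q a b c d ^ n *
      ((genK1 q a b c d * genK0 q a b c d) ^ (i : ℕ) * genK1 q a b c d ^ m)) ∈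
      monomialSpan q a b c d := by
  have hu (n m : ℕ) := mul_pow_mul_mem (q := q) (a := a) (b := b) (c := c) (d := d) (n := n)
    (m := m) two_pos
  have hv (n m : ℕ) := mul_pow_mul_mem (q := q) (a := a) (b := b) (c := c) (d := d) (n := n)
    (m := m) one_lt_two
  simp only [pow_zero, pow_one, one_mul] at hu hv
  have hsm := fun (r : ℂ) {x : AWQ q a b c d} =>
    Submodule.smul_mem (monomialSpan q a b c d) r (x := x)
  have ss {v} := @genS_mul_mem q a b c d v
  induction n using Nat.strong_induction_on generalizing m with
  | _ n ih =>
    match n with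
    | 0 =>
      fin_cases i
      · simpa [pow_succ'] using hu 0 (m + 1)
      -- The word is `K₁²K₀K₁ᵐ`; after rewriting, `K₁K₀K₁ᵐ⁺¹` and `K₀K₁ᵐ⁺²` are already in the list.
      · have e := congrArg (· * genK1 q a b c d ^ m) (genK1_sq_mul_genK0 q a b c d)
        have h1 := hu 0 m
        have h2 := hu 0 (m + 1)
        have h3 := hu 1 (m + 2)
        have h4 := hv 0 (m + 1)
        have h5 := hu 1 m
        simp only [pow_zero, one_mul, pow_one, pow_succ' _ (m + 1), pow_succ' _ m, mul_assoc]
          at h1 h2 h3 h4 h5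
        simp only [← commute_genS_genK1.eq, sub_mul, add_mul, smul_mul_assoc, mul_assoc,
          one_mul] at e
        simp only [pow_zero, one_mul, pow_one, mul_assoc]
        rw [e]
        exact sub_mem (sub_mem (hsm _ h4) h3) (add_mem (add_mem (add_mem (add_mem (hsm _ h2)
          (hsm _ h5)) (hsm _ h1)) (hsm _ (ss h2))) (hsm _ (ss h1)))
    | 1 =>
      fin_cases i
      · simpa [mul_assoc] using hv 0 m
      -- The word is `(K₁K₀)²K₁ᵐ`; every term of the rewritten form has `i ≤ 1`, up to a left factor
      -- `T₁ + ab`.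
      · have e := congrArg (· * genK1 q a b c d ^ m) (genK1_mul_genK0_mul_self q a b c d)
        have h1 := hu 0 m
        have h2 := hu 0 (m + 1)
        have h3 := hu 0 (m + 2)
        have h4 := hu 1 m
        have h5 := hu 1 (m + 1)
        have h6 := hu 2 m
        have h7 := hu 2 (m + 2)
        have h8 := hv 0 m
        have h9 := hv 1 (m + 1)
        simp only [pow_zero, one_mul, pow_one, pow_two, pow_succ' _ (m + 1), pow_succ' _ m,
          mul_assoc] at h1 h2 h3 h4 h5 h6 h7 h8 h9
        simp only [sub_mul, add_mul, mul_add, smul_mul_assoc, mul_smul_comm, mul_assoc,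
          one_mul] at e
        simp only [pow_one, mul_assoc]
        rw [e]
        refine sub_mem (add_mem (hsm _ h1) (hsm _ h9)) ?_
        refine add_mem (add_mem (add_mem (add_mem (add_mem
          (hsm _ h7) (hsm _ (add_mem (hsm _ h6) (hsm _ h3)))) ?_) ?_) ?_) (hsm _ (ss h1))
        · exact add_mem (hsm _ (add_mem (hsm _ h5) (hsm _ (ss h5))))
            (add_mem (hsm _ h8) (hsm _ (ss h8)))
        · exact hsm _ (add_mem (hsm _ h4) (hsm _ (ss h4)))
        · exact hsm _ (add_mem (hsm _ h2) (hsm _ (ss h2)))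
    | n + 2 =>
      -- Rewriting `K₁K₀²` leaves `K₁` in front of `K₀ⁿ⁺¹` or `K₀ⁿ` only, so the induction
      -- hypothesis applies.
      have e := congrArg (· * (genK0 q a b c d ^ n *
        ((genK1 q a b c d * genK0 q a b c d) ^ (i : ℕ) * genK1 q a b c d ^ m)))
        (genK1_mul_genK0_sq q a b c d)
      have h0 := mul_pow_mul_mem (q := q) (a := a) (b := b) (c := c) (d := d) (n := n) (m := m) i.2
      have h1 := ih n (by omega) m
      have h2 := ih (n + 1) (by omega) m
      simp only [sub_mul, add_mul, smul_mul_assoc, mul_assoc, one_mul] at e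
      simp only [pow_succ' _ (n + 1), pow_succ' _ n, mul_assoc] at h0 h1 h2 ⊢
      rw [e]
      have k0 {v} := @genK0_mul_mem q a b c d v
      exact sub_mem (sub_mem (hsm _ (k0 h2)) (k0 (k0 h1))) (add_mem (add_mem (add_mem (add_mem
        (hsm _ (k0 h0)) (hsm _ h1)) (hsm _ h0)) (hsm _ (k0 (ss h0)))) (hsm _ (ss h0)))

theorem genK1_mul_mem {v : AWQ q a b c d} (hv : v ∈ monomialSpan q a b c d) :
    genK1 q a b c d * v ∈ monomialSpan q a b c d := by
  refine mul_mem_monomialSpan (fun n m i j => ?_) hv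
  have h := genK1_mul_pow_mul_mem (q := q) (a := a) (b := b) (c := c) (d := d) n m i
  have hc : Commute (genT1 q a b c d ^ (j : ℕ)) (genK1 q a b c d * monomialAW q a b c d n i m 0) :=
    ((commute_genT1_genK1 q a b c d).mul_right (commute_genT1_monomialAW n i m 0)).pow_left _
  have e : genK1 q a b c d * monomialAW q a b c d n i m j =
      genT1 q a b c d ^ (j : ℕ) * (genK1 q a b c d * (genK0 q a b c d ^ n *
      ((genK1 q a b c d * genK0 q a b c d) ^ (i : ℕ) * genK1 q a b c d ^ m))) := by
    simp only [monomialAW, pow_zero, mul_one, mul_assoc] at hc ⊢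
    rw [hc.eq]
    simp only [mul_assoc]
  rw [e]
  fin_cases j
  · simpa using h
  · simpa using genT1_mul_mem h

/-- A subspace that contains `1` and is stable under left multiplication by the generators is the
whole algebra. -/
theorem monomialSpan_eq_top : monomialSpan q a b c d = ⊤ := by
  refine Submodule.eq_top_iff'.2 fun x => ?_
  obtain ⟨y, rfl⟩ := RingQuot.mkAlgHom_surjective ℂ (Rel q a b c d) x
  suffices h : ∀ v ∈ monomialSpan q a b c d,
      RingQuot.mkAlgHom ℂ (Rel q a b c d) y * v ∈ monomialSpan q a b c d by
    have h1 : (1 : AWQ q a b c d) ∈ monomialSpan q a b c d := by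
      simpa [monomialAW] using monomialAW_mem (q := q) (a := a) (b := b) (c := c) (d := d)
        (n := 0) (m := 0) two_pos two_pos
    simpa using h 1 h1
  induction y using FreeAlgebra.induction with
  | grade0 r =>
    intro v hv
    rw [AlgHom.commutes, ← Algebra.smul_def]
    exact Submodule.smul_mem _ _ hv
  | grade1 g =>
    intro v hv
    cases g with
    | k0 => exact genK0_mul_mem hv
    | k1 => exact genK1_mul_mem hv
    | t1 => exact genT1_mul_mem hv
  | mul y z hy hz =>
    intro v hv
    rw [map_mul, mul_assoc]
    exact hy _ (hz _ hv)
  | add y z hy hz =>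
    intro v hv
    rw [map_add, add_mul]
    exact add_mem (hy _ hv) (hz _ hv)

end Span

/-! ## Functions of `x⁻¹ + p x` vanishing on a geometric progression -/

/-- Functions on the punctured plane given by Laurent polynomials. -/
def IsLaurentFun (F : ℂ → ℂ) : Prop :=
  ∃ (L : ℕ) (P : Polynomial ℂ), ∀ x, x ≠ 0 → x ^ L * F x = P.eval x

namespace IsLaurentFun

theorem const (r : ℂ) : IsLaurentFun fun _ => r := ⟨0, Polynomial.C r, by simp⟩

theorem id : IsLaurentFun fun x => x := ⟨0, Polynomial.X, by simp⟩

theorem inv : IsLaurentFun fun x => x⁻¹ :=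
  ⟨1, 1, fun x hx => by simp [hx]⟩

theorem add {F G : ℂ → ℂ} (hF : IsLaurentFun F) (hG : IsLaurentFun G) :
    IsLaurentFun fun x => F x + G x := by
  obtain ⟨L, P, hP⟩ := hF
  obtain ⟨M, Q, hQ⟩ := hG
  refine ⟨L + M, Polynomial.X ^ M * P + Polynomial.X ^ L * Q, fun x hx => ?_⟩
  simp only [Polynomial.eval_add, Polynomial.eval_mul, Polynomial.eval_pow, Polynomial.eval_X,
    ← hP x hx, ← hQ x hx]
  ring

theorem mul {F G : ℂ → ℂ} (hF : IsLaurentFun F) (hG : IsLaurentFun G) :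
    IsLaurentFun fun x => F x * G x := by
  obtain ⟨L, P, hP⟩ := hF
  obtain ⟨M, Q, hQ⟩ := hG
  refine ⟨L + M, P * Q, fun x hx => ?_⟩
  simp only [Polynomial.eval_mul, ← hP x hx, ← hQ x hx]
  ring

theorem eval (P : Polynomial ℂ) {F : ℂ → ℂ} (hF : IsLaurentFun F) :
    IsLaurentFun fun x => P.eval (F x) := by
  induction P using Polynomial.induction_on with
  | C r => simpa using const r
  | add P Q hP hQ => simpa using hP.add hQ
  | monomial n r h =>
    have := h.mul hF
    simpa only [Polynomial.eval_mul, Polynomial.eval_C, Polynomial.eval_pow, Polynomial.eval_X,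
      pow_succ, mul_assoc] using this

/-- Clearing denominators leaves a polynomial with infinitely many roots. -/
theorem eq_zero {F : ℂ → ℂ} (hF : IsLaurentFun F) {u : ℕ → ℂ} (hu : Function.Injective u)
    (hu0 : ∀ k, u k ≠ 0) (h : ∀ k, F (u k) = 0) {x : ℂ} (hx : x ≠ 0) : F x = 0 := by
  obtain ⟨L, P, hP⟩ := hF
  have hP0 : P = 0 := by
    refine P.eq_zero_of_infinite_isRoot ((Set.infinite_range_of_injective hu).mono ?_)
    rintro _ ⟨k, rfl⟩
    simp [Polynomial.IsRoot, ← hP _ (hu0 k), h]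
  have := hP x hx
  rw [hP0, Polynomial.eval_zero] at this
  exact (mul_eq_zero.1 this).resolve_left (pow_ne_zero _ hx)

end IsLaurentFun

/-- The map `x ↦ x⁻¹ + p x` is onto, with prescribed value of `x⁻¹ - p x`. -/
theorem exists_inv_add_mul {p : ℂ} (hp : p ≠ 0) (y s : ℂ) (hs : s ^ 2 = y ^ 2 - 4 * p) :
    ∃ x, x ≠ 0 ∧ x⁻¹ + p * x = y ∧ x⁻¹ - p * x = s := by
  have h1 : (y + s) * (y - s) = 4 * p := by linear_combination -hs
  have h2 : y + s ≠ 0 := left_ne_zero_of_mul (h1 ▸ mul_ne_zero (by norm_num) hp)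
  -- Solving for `x⁻¹` and `p x` gives `(y + s) / 2` and `(y - s) / 2`; these are compatible because
  -- their product is `p`.
  refine ⟨2 / (y + s), div_ne_zero two_ne_zero h2, ?_, ?_⟩
  · field_simp
    linear_combination -h1
  · field_simp
    linear_combination h1

/-- The eigenvalue `q⁻ⁿ + p qⁿ`. -/
def eigen (q p : ℂ) (n : ℤ) : ℂ := (q ^ n)⁻¹ + p * q ^ n

theorem zpow_injective_of_pow_ne_one {q : ℂ} (hq : q ≠ 0) (hq1 : ∀ m : ℕ, 1 ≤ m → q ^ m ≠ 1)
    (M : ℤ) : Function.Injective fun k : ℕ => q ^ (M + k) := by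
  refine Function.Injective.of_lt_imp_ne fun i j hij h => hq1 (j - i) (by omega) ?_
  have e : q ^ (M + j) = q ^ (M + i) * q ^ (j - i) := by
    rw [← zpow_natCast q (j - i), ← zpow_add₀ hq]; congr 1; omega
  exact mul_left_cancel₀ (zpow_ne_zero (M + i) hq) (by rw [mul_one, ← e]; exact h.symm)

/-- As `q` is not a root of unity, the identity extends from `x = q ^ (M + k)` to all `x ≠ 0`. The
symmetry `x ↦ (p x)⁻¹` fixes `x⁻¹ + p x` but not its shift by `q`, and this separates `R` from `P`.
-/
theorem eq_zero_of_eval_eigen {q p : ℂ} (hq : q ≠ 0) (hq1 : ∀ m : ℕ, 1 ≤ m → q ^ m ≠ 1)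
    (hp : p ≠ 0) (P R : Polynomial ℂ) (M : ℤ)
    (h : ∀ k : ℕ, P.eval (eigen q p (M + k)) +
      R.eval (eigen q p (M + k)) * eigen q p (M + k - 1) = 0) : P = 0 ∧ R = 0 := by
  have hG : IsLaurentFun fun x => x⁻¹ + p * x :=
    IsLaurentFun.inv.add ((IsLaurentFun.const p).mul IsLaurentFun.id)
  have hF : IsLaurentFun fun x =>
      P.eval (x⁻¹ + p * x) + R.eval (x⁻¹ + p * x) * (q * x⁻¹ + p * q⁻¹ * x) :=
    (hG.eval P).add ((hG.eval R).mul (((IsLaurentFun.const q).mul IsLaurentFun.inv).add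
      ((IsLaurentFun.const (p * q⁻¹)).mul IsLaurentFun.id)))
  have hz : ∀ x : ℂ, x ≠ 0 →
      P.eval (x⁻¹ + p * x) + R.eval (x⁻¹ + p * x) * (q * x⁻¹ + p * q⁻¹ * x) = 0 := by
    intro x hx
    refine hF.eq_zero (zpow_injective_of_pow_ne_one hq hq1 M) (fun k => zpow_ne_zero _ hq)
      (fun k => ?_) hx
    rw [← h k, eigen, eigen, zpow_sub_one₀ hq, mul_inv, inv_inv]
    ring
  have hqq : q - q⁻¹ ≠ 0 := by
    intro h0
    refine hq1 2 one_le_two ?_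
    field_simp at h0
    linear_combination h0
  -- Subtracting the identity at `(p x)⁻¹` from that at `x` cancels `P` and leaves the factor `(q -
  -- q⁻¹)(x⁻¹ - p x)`.
  have hR : ∀ x : ℂ, x ≠ 0 → R.eval (x⁻¹ + p * x) * (x⁻¹ - p * x) = 0 := by
    intro x hx
    have h1 := hz x hx
    have h2 := hz (p * x)⁻¹ (inv_ne_zero (mul_ne_zero hp hx))
    have e : ((p * x)⁻¹)⁻¹ + p * (p * x)⁻¹ = x⁻¹ + p * x := by field_simp; ring
    have e' : q * ((p * x)⁻¹)⁻¹ + p * q⁻¹ * (p * x)⁻¹ = q * (p * x) + q⁻¹ * x⁻¹ := by field_simp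
    rw [e, e'] at h2
    refine (mul_eq_zero.1 (?_ : (q - q⁻¹) * _ = 0)).resolve_left hqq
    linear_combination h1 - h2
  have hsq : ∀ y : ℂ, ∃ s : ℂ, s ^ 2 = y ^ 2 - 4 * p := fun y =>
    IsAlgClosed.exists_pow_nat_eq _ two_pos
  have hR0 : R = 0 := by
    -- Multiplying by `s = x⁻¹ - p x` once more makes the factor `s² = y² - 4p` a polynomial in `y =
    -- x⁻¹ + p x`.
    have e : R * (Polynomial.X ^ 2 - Polynomial.C (4 * p)) = 0 := by
      refine Polynomial.funext fun y => ?_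
      obtain ⟨s, hs⟩ := hsq y
      obtain ⟨x, hx, hy, hxs⟩ := exists_inv_add_mul hp y s hs
      have := hR x hx
      rw [hy, hxs] at this
      simp only [Polynomial.eval_mul, Polynomial.eval_sub, Polynomial.eval_pow, Polynomial.eval_X,
        Polynomial.eval_C, Polynomial.eval_zero, ← hs]
      linear_combination s * this
    exact (mul_eq_zero.1 e).resolve_right (Polynomial.X_pow_sub_C_ne_zero two_pos _)
  refine ⟨Polynomial.funext fun y => ?_, hR0⟩
  obtain ⟨s, hs⟩ := hsq y
  obtain ⟨x, hx, hy, -⟩ := exists_inv_add_mul hp y s hs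
  simpa [hR0, hy] using hz x hx

/-! ## Triangularity of `D` -/

/-- The Laurent polynomials with exponents in `(-n, n)`. -/
def lowDeg (n : ℕ) : Submodule ℂ ℂ[T;T⁻¹] :=
  Submodule.span ℂ (T '' {j : ℤ | |j| < n})

/-- The coefficient of `z ^ n`. -/
def coeffAt (n : ℤ) : ℂ[T;T⁻¹] →ₗ[ℂ] ℂ :=
  Finsupp.lapply n ∘ₗ (AddMonoidAlgebra.coeffLinearEquiv ℂ).toLinearMap

theorem coeffAt_T (n m : ℤ) : coeffAt n (T m) = if m = n then 1 else 0 := T_apply n m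

theorem T_mem_lowDeg {n : ℕ} {j : ℤ} (h : |j| < n) : T j ∈ lowDeg n :=
  Submodule.subset_span ⟨j, h, rfl⟩

theorem lowDeg_mono {n m : ℕ} (h : n ≤ m) : lowDeg n ≤ lowDeg m :=
  Submodule.span_mono (Set.image_mono fun j (hj : |j| < n) => show |j| < m by omega)

theorem lowDeg_le_comap {n m : ℕ} {A : ℂ[T;T⁻¹] →ₗ[ℂ] ℂ[T;T⁻¹]}
    (h : ∀ j : ℤ, |j| < n → A (T j) ∈ lowDeg m) : lowDeg n ≤ (lowDeg m).comap A := by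
  refine Submodule.span_le.2 ?_
  rintro _ ⟨j, hj, rfl⟩
  exact h j hj

theorem T_mul_mem_lowDeg {n : ℕ} {i : ℤ} (hi : |i| ≤ 1) {f : ℂ[T;T⁻¹]} (hf : f ∈ lowDeg n) :
    T i * f ∈ lowDeg (n + 1) := by
  refine lowDeg_le_comap (A := LinearMap.mulLeft ℂ (T i)) (fun j hj => ?_) hf
  rw [LinearMap.mulLeft_apply, ← T_add]
  refine T_mem_lowDeg ?_
  have := abs_add_le i j
  push_cast
  omega

theorem coeffAt_eq_zero {n : ℕ} {m : ℤ} (h : n ≤ m) {f : ℂ[T;T⁻¹]} (hf : f ∈ lowDeg n) :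
    coeffAt m f = 0 := by
  have : lowDeg n ≤ LinearMap.ker (coeffAt m) := by
    refine Submodule.span_le.2 ?_
    rintro _ ⟨j, hj, rfl⟩
    have hj : |j| < n := hj
    have := le_abs_self j
    rw [SetLike.mem_coe, LinearMap.mem_ker, coeffAt_T, if_neg (by omega)]
  exact this hf

theorem opX_mem_lowDeg {n : ℕ} {f : ℂ[T;T⁻¹]} (hf : f ∈ lowDeg n) : opX f ∈ lowDeg (n + 1) := by
  rw [opX_apply]
  exact add_mem (T_mul_mem_lowDeg (by simp) hf) (T_mul_mem_lowDeg (by simp) hf)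

theorem coeffAt_opX {n : ℕ} {f : ℂ[T;T⁻¹]} (hf : f ∈ lowDeg (n + 1)) :
    coeffAt (n + 1) (opX f) = coeffAt n f := by
  refine LinearMap.eqOn_span (f := coeffAt (n + 1) ∘ₗ opX) (g := coeffAt n) ?_ hf
  rintro _ ⟨j, hj, rfl⟩
  have hj : |j| < (n + 1 : ℕ) := hj
  have := le_abs_self j
  push_cast at hj
  simp only [LinearMap.comp_apply, opX_apply, LinearMap.mulLeft_apply, ← T_add, map_add, coeffAt_T]
  rw [if_neg (by omega : ¬ -1 + j = n + 1), add_zero]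
  exact if_congr (by omega) rfl rfl

section Triangular

variable {q : ℂ} (hq : q ≠ 0) (a b c d : ℂ)

theorem opT1_one : opT1 a b 1 = -(a * b) • (1 : ℂ[T;T⁻¹]) := by
  have : divDiff 1 (1 : ℂ[T;T⁻¹]) = 0 := by
    rw [← T_zero, divDiff, ofMonomials_T]
    change -(_ * _) = _
    simp
  rw [opT1_apply, this, smul_eq_C_mul]
  simp

theorem opT0_one (q : ℂ) : opT0 q c d 1 = -(q⁻¹ * c * d) • (1 : ℂ[T;T⁻¹]) := by
  have : divDiff q (1 : ℂ[T;T⁻¹]) = 0 := by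
    rw [← T_zero, divDiff, ofMonomials_T]
    change -(_ * _) = _
    simp
  rw [opT0_apply, this, smul_eq_C_mul]
  simp

theorem T_succ (n : ℕ) : (T ((n + 1 : ℕ) : ℤ) : ℂ[T;T⁻¹]) = LinearMap.mulLeft ℂ (T 1) (T n) := by
  rw [LinearMap.mulLeft_apply, ← T_add]; congr 1; push_cast; ring

theorem T_neg_succ (n : ℕ) :
    (T (-((n + 1 : ℕ) : ℤ)) : ℂ[T;T⁻¹]) = LinearMap.mulLeft ℂ (T (-1)) (T (-n)) := by
  rw [LinearMap.mulLeft_apply, ← T_add]; congr 1; push_cast; ring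

theorem mulLeft_T_mem_lowDeg {n : ℕ} {i j : ℤ} (h : |i + j| < n) :
    LinearMap.mulLeft ℂ (T i) (T j : ℂ[T;T⁻¹]) ∈ lowDeg n := by
  rw [LinearMap.mulLeft_apply, ← T_add]
  exact T_mem_lowDeg h

theorem mulLeft_mem_lowDeg {n : ℕ} {i : ℤ} (hi : |i| ≤ 1) {f : ℂ[T;T⁻¹]} (hf : f ∈ lowDeg n) :
    LinearMap.mulLeft ℂ (T i) f ∈ lowDeg (n + 1) :=
  T_mul_mem_lowDeg hi hf

/-- Each of these four leading-term formulas follows by induction on the exponent from the matching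
cross relation of the Hecke algebra. -/
theorem opT1_T (n : ℕ) : opT1 a b (T (n + 1 : ℕ)) - T (-(n + 1 : ℕ)) ∈ lowDeg (n + 1) := by
  -- The relations for `T₁` do not involve `q`, `c`, `d`, so any admissible values serve.
  have h := isHeckeModule_laurent one_ne_zero a b 0 0
  induction n with
  | zero =>
    have e : opT1 a b (T (0 + 1 : ℕ)) - T (-(0 + 1 : ℕ)) = -(a + b) • T 0 := by
      rw [T_succ, T_neg_succ, h.T₁Z, Nat.cast_zero, neg_zero, T_zero, opT1_one, map_smul]
      module
    rw [e]
    exact Submodule.smul_mem _ _ (T_mem_lowDeg (by simp))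
  | succ n ih =>
    have e : opT1 a b (T (n + 1 + 1 : ℕ)) - T (-(n + 1 + 1 : ℕ)) =
        LinearMap.mulLeft ℂ (T (-1)) (opT1 a b (T (n + 1 : ℕ)) - T (-(n + 1 : ℕ))) +
          (a * b + 1) • LinearMap.mulLeft ℂ (T (-1)) (T (n + 1 : ℕ)) -
          (a + b) • T (n + 1 : ℕ) := by
      rw [T_succ (n + 1), T_neg_succ (n + 1), h.T₁Z, map_sub]
      module
    rw [e]
    exact sub_mem (add_mem (mulLeft_mem_lowDeg (by simp) ih)
      (Submodule.smul_mem _ _ (mulLeft_T_mem_lowDeg (by rw [abs_lt]; push_cast; omega))))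
      (Submodule.smul_mem _ _ (T_mem_lowDeg (by rw [abs_lt]; push_cast; omega)))

theorem opT1_T_neg (n : ℕ) : opT1 a b (T (-(n + 1 : ℕ))) + (a * b + 1) • T (-(n + 1 : ℕ)) +
    (a * b) • T (n + 1 : ℕ) ∈ lowDeg (n + 1) := by
  have h := isHeckeModule_laurent one_ne_zero a b 0 0
  induction n with
  | zero =>
    have e : opT1 a b (T (-(0 + 1 : ℕ))) + (a * b + 1) • T (-(0 + 1 : ℕ)) +
        (a * b) • T (0 + 1 : ℕ) = (a + b) • T 0 := by
      rw [T_succ, T_neg_succ, h.T₁W, Nat.cast_zero, neg_zero, T_zero, opT1_one, map_smul]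
      module
    rw [e]
    exact Submodule.smul_mem _ _ (T_mem_lowDeg (by simp))
  | succ n ih =>
    have e : opT1 a b (T (-(n + 1 + 1 : ℕ))) + (a * b + 1) • T (-(n + 1 + 1 : ℕ)) +
        (a * b) • T (n + 1 + 1 : ℕ) =
        LinearMap.mulLeft ℂ (T 1) (opT1 a b (T (-(n + 1 : ℕ))) +
          (a * b + 1) • T (-(n + 1 : ℕ)) + (a * b) • T (n + 1 : ℕ)) -
          (a * b + 1) • LinearMap.mulLeft ℂ (T 1) (T (-(n + 1 : ℕ))) +
          (a + b) • T (-(n + 1 : ℕ)) := by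
      rw [T_succ (n + 1), T_neg_succ (n + 1), h.T₁W, map_add, map_add, map_smul, map_smul]
      module
    rw [e]
    exact add_mem (sub_mem (mulLeft_mem_lowDeg (by simp) ih)
      (Submodule.smul_mem _ _ (mulLeft_T_mem_lowDeg (by rw [abs_lt]; push_cast; omega))))
      (Submodule.smul_mem _ _ (T_mem_lowDeg (by rw [abs_lt]; push_cast; omega)))

include hq in
theorem opT0_T (n : ℕ) : opT0 q c d (T (n + 1 : ℕ)) + (q⁻¹ * c * d + 1) • T (n + 1 : ℕ) +
    (q⁻¹ * c * d * q ^ (n + 1)) • T (-(n + 1 : ℕ)) ∈ lowDeg (n + 1) := by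
  have h := isHeckeModule_laurent hq 0 0 c d
  induction n with
  | zero =>
    have e : opT0 q c d (T (0 + 1 : ℕ)) + (q⁻¹ * c * d + 1) • T (0 + 1 : ℕ) +
        (q⁻¹ * c * d * q ^ (0 + 1)) • T (-(0 + 1 : ℕ)) = (c + d) • T 0 := by
      rw [T_succ, T_neg_succ, h.T₀Z, Nat.cast_zero, neg_zero, T_zero, opT0_one, map_smul]
      match_scalars <;> ring
    rw [e]
    exact Submodule.smul_mem _ _ (T_mem_lowDeg (by simp))
  | succ n ih =>
    have e : opT0 q c d (T (n + 1 + 1 : ℕ)) + (q⁻¹ * c * d + 1) • T (n + 1 + 1 : ℕ) +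
        (q⁻¹ * c * d * q ^ (n + 1 + 1)) • T (-(n + 1 + 1 : ℕ)) =
        q • LinearMap.mulLeft ℂ (T (-1)) (opT0 q c d (T (n + 1 : ℕ)) +
          (q⁻¹ * c * d + 1) • T (n + 1 : ℕ) +
          (q⁻¹ * c * d * q ^ (n + 1)) • T (-(n + 1 : ℕ))) -
        (q * (q⁻¹ * c * d + 1)) • LinearMap.mulLeft ℂ (T (-1)) (T (n + 1 : ℕ)) +
        (c + d) • T (n + 1 : ℕ) := by
      rw [T_succ (n + 1), T_neg_succ (n + 1), h.T₀Z, map_add, map_add, map_smul, map_smul]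
      match_scalars <;> ring
    rw [e]
    exact add_mem (sub_mem (Submodule.smul_mem _ _ (mulLeft_mem_lowDeg (by simp) ih))
      (Submodule.smul_mem _ _ (mulLeft_T_mem_lowDeg (by rw [abs_lt]; push_cast; omega))))
      (Submodule.smul_mem _ _ (T_mem_lowDeg (by rw [abs_lt]; push_cast; omega)))

include hq in
theorem opT0_T_neg (n : ℕ) :
    opT0 q c d (T (-(n + 1 : ℕ))) - (q⁻¹ ^ (n + 1)) • T (n + 1 : ℕ) ∈ lowDeg (n + 1) := by
  have h := isHeckeModule_laurent hq 0 0 c d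
  induction n with
  | zero =>
    have e : opT0 q c d (T (-(0 + 1 : ℕ))) - (q⁻¹ ^ (0 + 1)) • T (0 + 1 : ℕ) =
        -(q⁻¹ * (c + d)) • T 0 := by
      rw [T_succ, T_neg_succ, h.T₀W, Nat.cast_zero, neg_zero, T_zero, opT0_one, map_smul]
      match_scalars <;> ring
    rw [e]
    exact Submodule.smul_mem _ _ (T_mem_lowDeg (by simp))
  | succ n ih =>
    have e : opT0 q c d (T (-(n + 1 + 1 : ℕ))) - (q⁻¹ ^ (n + 1 + 1)) • T (n + 1 + 1 : ℕ) =
        q⁻¹ • LinearMap.mulLeft ℂ (T 1) (opT0 q c d (T (-(n + 1 : ℕ))) -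
          (q⁻¹ ^ (n + 1)) • T (n + 1 : ℕ)) +
        (q⁻¹ * (q⁻¹ * c * d + 1)) • LinearMap.mulLeft ℂ (T 1) (T (-(n + 1 : ℕ))) -
        (q⁻¹ * (c + d)) • T (-(n + 1 : ℕ)) := by
      rw [T_succ (n + 1), T_neg_succ (n + 1), h.T₀W, map_sub, map_smul]
      match_scalars <;> ring
    rw [e]
    exact sub_mem (add_mem (Submodule.smul_mem _ _ (mulLeft_mem_lowDeg (by simp) ih))
      (Submodule.smul_mem _ _ (mulLeft_T_mem_lowDeg (by rw [abs_lt]; push_cast; omega))))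
      (Submodule.smul_mem _ _ (T_mem_lowDeg (by rw [abs_lt]; push_cast; omega)))

theorem eq_zero_or_eq_succ (j : ℤ) :
    j = 0 ∨ ∃ n : ℕ, |j| = (n + 1 : ℕ) ∧ (j = (n + 1 : ℕ) ∨ j = -(n + 1 : ℕ)) := by
  by_cases h : j = 0
  · exact Or.inl h
  · exact Or.inr ⟨j.natAbs - 1, by rcases abs_cases j with h | h <;> omega, by omega⟩

/-- An operator mapping each `z ^ j` into the span of `z ^ i` with `|i| ≤ |j|` preserves
`lowDeg`. -/
theorem mem_lowDeg_of_triangular {A : ℂ[T;T⁻¹] →ₗ[ℂ] ℂ[T;T⁻¹]} (h0 : A 1 ∈ lowDeg 1)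
    (h1 : ∀ n : ℕ, A (T (n + 1 : ℕ)) ∈ lowDeg (n + 2))
    (h2 : ∀ n : ℕ, A (T (-(n + 1 : ℕ))) ∈ lowDeg (n + 2)) {n : ℕ} {f : ℂ[T;T⁻¹]}
    (hf : f ∈ lowDeg n) : A f ∈ lowDeg n := by
  refine lowDeg_le_comap (A := A) (fun j hj => ?_) hf
  rcases eq_zero_or_eq_succ j with rfl | ⟨k, hk, rfl | rfl⟩
  · rw [T_zero]; exact lowDeg_mono (Nat.succ_le_of_lt (by simpa using hj)) h0
  · exact lowDeg_mono (by omega) (h1 k)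
  · exact lowDeg_mono (by omega) (h2 k)

theorem T_mem_lowDeg_succ (n : ℕ) : T (n + 1 : ℕ) ∈ lowDeg (n + 2) :=
  T_mem_lowDeg (by rw [abs_lt]; push_cast; omega)

theorem T_neg_mem_lowDeg_succ (n : ℕ) : T (-(n + 1 : ℕ)) ∈ lowDeg (n + 2) :=
  T_mem_lowDeg (by rw [abs_lt]; push_cast; omega)

theorem one_mem_lowDeg : (1 : ℂ[T;T⁻¹]) ∈ lowDeg 1 := by
  rw [← T_zero]; exact T_mem_lowDeg (by simp)

theorem opT1_mem_lowDeg {n : ℕ} {f : ℂ[T;T⁻¹]} (hf : f ∈ lowDeg n) :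
    opT1 a b f ∈ lowDeg n := by
  refine mem_lowDeg_of_triangular ?_ (fun n => ?_) (fun n => ?_) hf
  · rw [opT1_one]; exact Submodule.smul_mem _ _ one_mem_lowDeg
  · exact (Submodule.sub_mem_iff_left _ (T_neg_mem_lowDeg_succ n)).1
      (lowDeg_mono (by omega) (opT1_T a b n))
  · exact (Submodule.add_mem_iff_left _ (Submodule.smul_mem _ _ (T_neg_mem_lowDeg_succ n))).1
      ((Submodule.add_mem_iff_left _ (Submodule.smul_mem _ _ (T_mem_lowDeg_succ n))).1
        (lowDeg_mono (by omega) (opT1_T_neg a b n)))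

include hq in
theorem opT0_mem_lowDeg {n : ℕ} {f : ℂ[T;T⁻¹]} (hf : f ∈ lowDeg n) :
    opT0 q c d f ∈ lowDeg n := by
  refine mem_lowDeg_of_triangular ?_ (fun n => ?_) (fun n => ?_) hf
  · rw [opT0_one]; exact Submodule.smul_mem _ _ one_mem_lowDeg
  · exact (Submodule.add_mem_iff_left _ (Submodule.smul_mem _ _ (T_mem_lowDeg_succ n))).1
      ((Submodule.add_mem_iff_left _ (Submodule.smul_mem _ _ (T_neg_mem_lowDeg_succ n))).1
        (lowDeg_mono (by omega) (opT0_T hq c d n)))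
  · exact (Submodule.sub_mem_iff_left _ (Submodule.smul_mem _ _ (T_mem_lowDeg_succ n))).1
      (lowDeg_mono (by omega) (opT0_T_neg hq c d n))

include hq in
theorem heckeD_mem_lowDeg {n : ℕ} {f : ℂ[T;T⁻¹]} (hf : f ∈ lowDeg n) :
    heckeD q a b c d (opT1 a b) (opT0 q c d) f ∈ lowDeg n := by
  have h1 {g} := @opT1_mem_lowDeg a b n g
  have h0 {g} := @opT0_mem_lowDeg q hq c d n g
  rw [IsHeckeModule.heckeD_apply]
  exact add_mem (add_mem (add_mem (add_mem (h1 (h0 hf)) (h0 (h1 hf)))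
    (Submodule.smul_mem _ _ (h0 hf))) (Submodule.smul_mem _ _ (h1 hf))) (Submodule.smul_mem _ _ hf)

include hq in
/-- `D` is triangular with eigenvalues `q⁻ⁿ + q⁻¹ abcd qⁿ`. -/
theorem heckeD_sub_mem_lowDeg {n : ℕ} {f : ℂ[T;T⁻¹]} (hf : f ∈ lowDeg (n + 1)) :
    heckeD q a b c d (opT1 a b) (opT0 q c d) f -
      eigen q (a * b * (q⁻¹ * c * d)) n • f ∈ lowDeg n := by
  refine lowDeg_le_comap (A := heckeD q a b c d (opT1 a b) (opT0 q c d) -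
    eigen q (a * b * (q⁻¹ * c * d)) n • LinearMap.id) (fun j hj => ?_) hf
  rw [LinearMap.sub_apply, LinearMap.smul_apply, LinearMap.id_apply]
  have hlow : |j| < n → heckeD q a b c d (opT1 a b) (opT0 q c d) (T j) -
      eigen q (a * b * (q⁻¹ * c * d)) n • T j ∈ lowDeg n := fun hj =>
    sub_mem (heckeD_mem_lowDeg hq a b c d (T_mem_lowDeg hj))
      (Submodule.smul_mem _ _ (T_mem_lowDeg hj))
  have hinv : q⁻¹ ^ n * q ^ n = 1 := by rw [← mul_pow, inv_mul_cancel₀ hq, one_pow]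
  simp only [eigen, zpow_natCast, ← inv_pow] at hlow ⊢
  rcases eq_zero_or_eq_succ j with rfl | ⟨k, hk, hjk⟩
  -- In degree zero the quotient is one-dimensional, and the eigenvalue comes from `T₁ 1 = -ab` and
  -- `T₀ 1 = -q⁻¹cd`.
  · rcases Nat.eq_zero_or_pos n with rfl | hn
    · have e : heckeD q a b c d (opT1 a b) (opT0 q c d) (T 0) -
          (q⁻¹ ^ 0 + a * b * (q⁻¹ * c * d) * q ^ 0) • (T 0 : ℂ[T;T⁻¹]) = 0 := by
        rw [IsHeckeModule.heckeD_apply, T_zero, opT1_one, opT0_one, map_smul, map_smul, opT1_one,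
          opT0_one]
        match_scalars
        ring
      rw [e]
      exact zero_mem _
    · exact hlow (by simpa using hn)
  · by_cases hkn : |j| < n
    · exact hlow hkn
    obtain rfl : n = k + 1 := by omega
    have r1 := opT1_T a b k
    have r2 := opT1_T_neg a b k
    have r3 := opT0_T hq c d k
    have r4 := opT0_T_neg hq c d k
    -- Modulo lower terms `Y = T₁T₀` is triangular on the span of `u` and `v`, with eigenvalues
    -- `q⁻ⁿ` on `v` and `p qⁿ` on `u`, `p = q⁻¹abcd`. Their product is `p`, so by Cayley–Hamilton `Y
    -- + p Y⁻¹` is the trace of `Y`, a scalar. The combinations `m` below verify this on `u` and on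
    -- `v`.
    set u : ℂ[T;T⁻¹] := T (k + 1 : ℕ)
    set v : ℂ[T;T⁻¹] := T (-(k + 1 : ℕ))
    have h1 {g} := @opT1_mem_lowDeg a b (k + 1) g
    have h0 {g} := @opT0_mem_lowDeg q hq c d (k + 1) g
    rcases hjk with rfl | rfl
    · have m := add_mem (add_mem (add_mem (sub_mem (sub_mem (h1 r3)
        (Submodule.smul_mem _ (q⁻¹ * c * d + 1) r1))
        (Submodule.smul_mem _ (q⁻¹ * c * d * q ^ (k + 1)) r2)) (add_mem (h0 r1) r4))
        (Submodule.smul_mem _ (a * b + 1) r3)) (Submodule.smul_mem _ (q⁻¹ * c * d + 1) r1)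
      convert m using 1
      simp only [IsHeckeModule.heckeD_apply, map_add, map_sub, map_smul]
      match_scalars <;> ring
    · have m := add_mem (add_mem (add_mem (add_mem (h1 r4)
        (Submodule.smul_mem _ (q⁻¹ ^ (k + 1)) r1))
        (sub_mem (sub_mem (h0 r2) (Submodule.smul_mem _ (a * b + 1) r4))
          (Submodule.smul_mem _ (a * b) r3)))
        (Submodule.smul_mem _ (a * b + 1) r4)) (Submodule.smul_mem _ (q⁻¹ * c * d + 1) r2)
      convert m using 1
      simp only [IsHeckeModule.heckeD_apply, map_add, map_sub, map_smul]
      match_scalars <;> ring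

end Triangular

/-! ## Linear independence -/

section Independence

variable {q p : ℂ} {D : Module.End ℂ ℂ[T;T⁻¹]}

theorem pow_triangular
    (hD : ∀ (n : ℕ) (f : ℂ[T;T⁻¹]), f ∈ lowDeg (n + 1) → D f - eigen q p n • f ∈ lowDeg n)
    {n : ℕ} {f : ℂ[T;T⁻¹]} (hf : f ∈ lowDeg (n + 1)) (k : ℕ) :
    (D ^ k) f ∈ lowDeg (n + 1) ∧ coeffAt n ((D ^ k) f) = eigen q p n ^ k * coeffAt n f := by
  induction k with
  | zero => simpa using hf
  | succ k ih =>
    obtain ⟨h1, h2⟩ := ih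
    have h := hD n _ h1
    rw [pow_succ', Module.End.mul_apply]
    constructor
    · exact (Submodule.sub_mem_iff_left _ (Submodule.smul_mem _ _ h1)).1
        (lowDeg_mono (Nat.le_succ n) h)
    · have := coeffAt_eq_zero le_rfl h
      rw [map_sub, map_smul, smul_eq_mul, h2] at this
      linear_combination this

theorem opX_pow_triangular {e : ℕ} {f : ℂ[T;T⁻¹]} (hf : f ∈ lowDeg (e + 1)) (m : ℕ) :
    (opX ^ m) f ∈ lowDeg (e + m + 1) ∧ coeffAt (e + m : ℕ) ((opX ^ m) f) = coeffAt e f := by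
  induction m with
  | zero => simpa using hf
  | succ m ih =>
    rw [pow_succ', Module.End.mul_apply]
    refine ⟨opX_mem_lowDeg ih.1, ?_⟩
    have := coeffAt_opX ih.1
    rw [ih.2] at this
    rw [← this]
    congr 1

/-- `Xᵐ` shifts the leading coefficient up to degree `e + m`; the factor `XD` picks up the
eigenvalue there before the shift to `e + m + 1`, and `Dⁿ` acts in the final degree. Hence two
consecutive eigenvalues appear when `i = 1`. -/
theorem monomial_triangular
    (hD : ∀ (n : ℕ) (f : ℂ[T;T⁻¹]), f ∈ lowDeg (n + 1) → D f - eigen q p n • f ∈ lowDeg n)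
    {e : ℕ} {f : ℂ[T;T⁻¹]} (hf : f ∈ lowDeg (e + 1)) (n m : ℕ) (i : Fin 2) :
    (D ^ n * (opX * D) ^ (i : ℕ) * opX ^ m) f ∈ lowDeg (e + m + i + 1) ∧
      coeffAt (e + m + i : ℕ) ((D ^ n * (opX * D) ^ (i : ℕ) * opX ^ m) f) =
        eigen q p (e + m + i : ℕ) ^ n * eigen q p (e + m : ℕ) ^ (i : ℕ) * coeffAt e f := by
  obtain ⟨h1, h2⟩ := opX_pow_triangular hf m
  rw [mul_assoc, Module.End.mul_apply, Module.End.mul_apply]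
  have key : ((opX * D) ^ (i : ℕ)) ((opX ^ m) f) ∈ lowDeg (e + m + i + 1) ∧
      coeffAt (e + m + i : ℕ) (((opX * D) ^ (i : ℕ)) ((opX ^ m) f)) =
        eigen q p (e + m : ℕ) ^ (i : ℕ) * coeffAt e f := by
    fin_cases i
    · simpa using ⟨h1, h2⟩
    · have h3 := pow_triangular hD h1 1
      have h4 := opX_pow_triangular h3.1 1
      simp only [pow_one] at h3 h4 ⊢
      rw [h3.2, h2] at h4
      exact h4
  have h5 := pow_triangular hD key.1 n
  refine ⟨h5.1, ?_⟩
  rw [h5.2, key.2]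
  ring

/-- Varying `k` moves the degree of the test vector `Xᵏf` along infinitely many eigenvalues, so
vanishing leading coefficients become polynomial identities. -/
theorem linearIndependent_monomials (hq : q ≠ 0) (hq1 : ∀ m : ℕ, 1 ≤ m → q ^ m ≠ 1) (hp : p ≠ 0)
    (hD : ∀ (n : ℕ) (f : ℂ[T;T⁻¹]), f ∈ lowDeg (n + 1) → D f - eigen q p n • f ∈ lowDeg n)
    {e : ℕ} {f : ℂ[T;T⁻¹]} (hf : f ∈ lowDeg (e + 1)) (hfe : coeffAt e f ≠ 0)
    (s : ℕ × Fin 2 × ℕ →₀ ℂ)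
    (hs : ∀ k : ℕ, (Finsupp.linearCombination ℂ
      (fun x : ℕ × Fin 2 × ℕ => D ^ x.1 * (opX * D) ^ (x.2.1 : ℕ) * opX ^ x.2.2) s)
        ((opX ^ k) f) = 0) : s = 0 := by
  by_contra hne
  -- A monomial raises the degree by `m + i`, so only those maximizing `m + i` reach the top
  -- exponent.
  obtain ⟨y, hy, hmax⟩ := s.support.exists_max_image (fun x => x.2.2 + (x.2.1 : ℕ))
    (Finsupp.support_nonempty_iff.2 hne)
  obtain ⟨N, hN⟩ : ∃ N, N = y.2.2 + (y.2.1 : ℕ) := ⟨_, rfl⟩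
  rw [← hN] at hmax
  -- `P i` collects the top monomials with the given `i`; the exponent of `K₀` becomes the degree in
  -- the eigenvalue.
  set P : Fin 2 → Polynomial ℂ := fun i => ∑ x ∈ s.support,
    if x.2.2 + (x.2.1 : ℕ) = N ∧ x.2.1 = i then Polynomial.monomial x.1 (s x) else 0 with hP
  have key : P 0 = 0 ∧ P 1 = 0 := by
    refine eq_zero_of_eval_eigen hq hq1 hp _ _ (e + N) fun k => ?_
    have h := congrArg (coeffAt (e + N + k : ℕ)) (hs k)
    rw [Finsupp.linearCombination_apply, Finsupp.sum, LinearMap.sum_apply, map_sum, map_zero] at h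
    refine (mul_eq_zero.1 (?_ : _ * coeffAt e f = 0)).resolve_right hfe
    rw [← h]
    simp only [hP, Polynomial.eval_finsetSum, Finset.sum_mul, ← Finset.sum_add_distrib]
    refine Finset.sum_congr rfl fun x hx => ?_
    obtain ⟨hk1, hk2⟩ := opX_pow_triangular hf k
    obtain ⟨h1, h2⟩ := monomial_triangular hD hk1 x.1 x.2.2 x.2.1
    rw [LinearMap.smul_apply, map_smul, smul_eq_mul]
    rcases (hmax x hx).lt_or_eq with hlt | heq
    · rw [coeffAt_eq_zero (by push_cast; omega) h1]
      simp [hlt.ne]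
    · rw [hk2] at h2
      have e1 : e + N + k = e + k + x.2.2 + x.2.1 := by omega
      rw [e1, h2]
      have e2 : ((e : ℤ) + N + k) = ((e + k + x.2.2 + x.2.1 : ℕ) : ℤ) := by
        rw [← e1]; push_cast; ring
      rw [e2]
      obtain ⟨n, i, m⟩ := x
      fin_cases i
      · simp at heq
        simp [heq]
        ring
      · simp at heq
        simp [heq]
        ring
  have hz : ∀ i, P i = 0 := fun i => by fin_cases i; exacts [key.1, key.2]
  -- Given `N` and `i`, the exponent `m = N - i` is determined, so this coefficient is exactly `s
  -- y`, which is nonzero.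
  have hc := congrArg (fun Q => Polynomial.coeff Q y.1) (hz y.2.1)
  simp only [hP, Polynomial.finsetSum_coeff, Polynomial.coeff_zero] at hc
  rw [Finset.sum_eq_single y] at hc
  · rw [if_pos ⟨hN.symm, rfl⟩, Polynomial.coeff_monomial, if_pos rfl] at hc
    exact Finsupp.mem_support_iff.1 hy hc
  · intro x _ hxy
    split_ifs with hx
    · rw [Polynomial.coeff_monomial, if_neg]
      intro hx1
      refine hxy (Prod.ext hx1 (Prod.ext hx.2 ?_))
      have := hx.1
      rw [hx.2] at this
      omega
    · rfl
  · exact fun h => absurd hy h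

end Independence

/-! ### Faithfulness of the polynomial representation -/

section Faithful

variable {q a b c d : ℂ}

/-- Every element is `A₀ + A₁ (T₁ + ab)` with `A₀`, `A₁` combinations of the monomials without
`T₁`. -/
theorem exists_eq_add_mul_genS (v : AWQ q a b c d) : ∃ s₀ s₁ : ℕ × Fin 2 × ℕ →₀ ℂ,
    v = Finsupp.linearCombination ℂ
        (fun x : ℕ × Fin 2 × ℕ => monomialAW q a b c d x.1 x.2.1 x.2.2 0) s₀ +
      Finsupp.linearCombination ℂ
        (fun x : ℕ × Fin 2 × ℕ => monomialAW q a b c d x.1 x.2.1 x.2.2 0) s₁ * genS q a b c d := by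
  have hv : v ∈ monomialSpan q a b c d := monomialSpan_eq_top ▸ Submodule.mem_top
  induction hv using Submodule.span_induction with
  | mem v hv =>
    obtain ⟨⟨n, i, m, j⟩, rfl⟩ := hv
    fin_cases j
    · exact ⟨Finsupp.single (n, i, m) 1, 0, by simp⟩
    · refine ⟨Finsupp.single (n, i, m) (-(a * b)), Finsupp.single (n, i, m) 1, ?_⟩
      have e : monomialAW q a b c d n i m 1 = monomialAW q a b c d n i m 0 * genT1 q a b c d := by
        simp [monomialAW]
      simp only [Finsupp.linearCombination_single, genS, Algebra.algebraMap_eq_smul_one, mul_add,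
        mul_smul_comm, mul_one, one_smul]
      refine e.trans ?_
      module
  | zero => exact ⟨0, 0, by simp⟩
  | add v w _ _ hv hw =>
    obtain ⟨s₀, s₁, hs⟩ := hv
    obtain ⟨r₀, r₁, hr⟩ := hw
    refine ⟨s₀ + r₀, s₁ + r₁, ?_⟩
    rw [hs, hr, map_add, map_add, add_mul]
    abel
  | smul r v _ hv =>
    obtain ⟨s₀, s₁, hs⟩ := hv
    refine ⟨r • s₀, r • s₁, ?_⟩
    rw [hs, map_smul, map_smul, smul_add, smul_mul_assoc]

theorem polyRep_injective (hq : q ≠ 0) (hq1 : ∀ m : ℕ, 1 ≤ m → q ^ m ≠ 1) (ha : a ≠ 0)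
    (hb : b ≠ 0) (hc : c ≠ 0) (hd : d ≠ 0) : Function.Injective (polyRep hq ha hb hc hd) := by
  refine (injective_iff_map_eq_zero _).2 fun v hv => ?_
  obtain ⟨s₀, s₁, rfl⟩ := exists_eq_add_mul_genS v
  have hp : a * b * (q⁻¹ * c * d) ≠ 0 := by positivity
  have hD : ∀ (n : ℕ) (f : ℂ[T;T⁻¹]), f ∈ lowDeg (n + 1) →
      opD q a b c d f - eigen q (a * b * (q⁻¹ * c * d)) n • f ∈ lowDeg n := fun n f hf => by
    rw [opD_eq_heckeD hq ha hb hc hd]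
    exact heckeD_sub_mem_lowDeg hq a b c d hf
  obtain ⟨S, hS⟩ : ∃ S, S = polyRep hq ha hb hc hd (genS q a b c d) := ⟨_, rfl⟩
  have hSf : ∀ f, S f = opT1 a b f + (a * b) • f := fun f => by
    rw [hS, genS, map_add, AlgHom.commutes, polyRep_genT1, LinearMap.add_apply,
      Module.algebraMap_end_apply]
  have hSX : Commute S opX := by
    rw [hS, ← polyRep_genK1 hq ha hb hc hd]
    exact commute_genS_genK1.map _
  have hSXk : ∀ (k : ℕ) (f : ℂ[T;T⁻¹]), S ((opX ^ k) f) = (opX ^ k) (S f) := fun k f =>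
    LinearMap.congr_fun (hSX.pow_right k).eq f
  have hlc : ∀ s : ℕ × Fin 2 × ℕ →₀ ℂ, polyRep hq ha hb hc hd (Finsupp.linearCombination ℂ
      (fun x : ℕ × Fin 2 × ℕ => monomialAW q a b c d x.1 x.2.1 x.2.2 0) s) =
      Finsupp.linearCombination ℂ (fun x : ℕ × Fin 2 × ℕ => opD q a b c d ^ x.1 *
        (opX * opD q a b c d) ^ (x.2.1 : ℕ) * opX ^ x.2.2) s := fun s => by
    simp only [Finsupp.linearCombination_apply, Finsupp.sum, map_sum, map_smul, monomialAW,
      map_mul, map_pow, polyRep_genK0, polyRep_genK1, pow_zero, mul_one]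
  rw [map_add, map_mul, hlc, hlc, ← hS] at hv
  -- Since `S` commutes with `X`, it kills every `Xᵏ 1`; on these vectors only the `s₀` part is
  -- seen.
  have hS1 : S 1 = 0 := by rw [hSf, opT1_one]; module
  have h0 : s₀ = 0 := by
    refine linearIndependent_monomials hq hq1 hp hD (e := 0) one_mem_lowDeg ?_ s₀ fun k => ?_
    · rw [← T_zero, coeffAt_T]; simp
    · have := LinearMap.congr_fun hv ((opX ^ k) 1)
      rwa [LinearMap.add_apply, Module.End.mul_apply, hSXk, hS1, map_zero, map_zero, add_zero,
        LinearMap.zero_apply] at this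
  rw [h0, map_zero, zero_add] at hv
  -- The test vector for `s₁`: its coefficient at `z` is `-ab ≠ 0`, so the independence criterion
  -- applies with `e = 1`.
  have hST : S (T (-1)) = (a + b) • T 0 - (a * b) • T 1 - T (-1) := by
    have := (isHeckeModule_laurent hq a b c d).T₁W 1
    rw [LinearMap.mulLeft_apply, LinearMap.mulLeft_apply, opT1_one, mul_one, mul_smul_comm,
      mul_one] at this
    rw [hSf, this, T_zero]
    module
  have h1 : s₁ = 0 := by
    refine linearIndependent_monomials hq hq1 hp hD (e := 1) (f := S (T (-1))) ?_ ?_ s₁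
      fun k => ?_
    · rw [hST]
      exact sub_mem (sub_mem (Submodule.smul_mem _ _ (T_mem_lowDeg (by simp)))
        (Submodule.smul_mem _ _ (T_mem_lowDeg (by simp)))) (T_mem_lowDeg (by simp))
    · rw [hST]
      simp only [map_sub, map_smul, coeffAt_T]
      simpa using mul_ne_zero ha hb
    · have := LinearMap.congr_fun hv ((opX ^ k) (T (-1)))
      rwa [Module.End.mul_apply, hSXk, LinearMap.zero_apply] at this
  rw [h0, h1, map_zero, zero_mul, add_zero]

end Faithful

end

end Zhedanov

theorem theorem6p2 (q a b c d : ℂ) (hq : q ≠ 0) (hq1 : ∀ m : ℕ, 1 ≤ m → q ^ m ≠ 1)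
    (ha : a ≠ 0) (hb : b ≠ 0) (hc : c ≠ 0) (hd : d ≠ 0)
    (habcd : ∀ m : ℕ, a * b * c * d ≠ (q ^ m)⁻¹) :
    (∃ ρ : Zhedanov.AWQ q a b c d →ₐ[ℂ] Module.End ℂ ℂ[T;T⁻¹],
      ρ (Zhedanov.genK0 q a b c d) = Zhedanov.opD q a b c d ∧
      (∀ f : ℂ[T;T⁻¹], ρ (Zhedanov.genK1 q a b c d) f =
        (LaurentPolynomial.T 1 + LaurentPolynomial.T (-1)) * f) ∧
      (∀ f : ℂ[T;T⁻¹], (1 - LaurentPolynomial.T 2) * ρ (Zhedanov.genT1 q a b c d) f =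
        (LaurentPolynomial.C (a + b) * LaurentPolynomial.T 1
            - LaurentPolynomial.C (1 + a * b)) * f
          + (1 - LaurentPolynomial.C a * LaurentPolynomial.T 1)
            * (1 - LaurentPolynomial.C b * LaurentPolynomial.T 1) * LaurentPolynomial.invert f) ∧
      Function.Injective ρ) ∧
    Submodule.span ℂ (Set.range fun x : ℕ × Fin 2 × ℕ × Fin 2 =>
      Zhedanov.genK0 q a b c d ^ x.1
        * (Zhedanov.genK1 q a b c d * Zhedanov.genK0 q a b c d) ^ (x.2.1 : ℕ)
        * Zhedanov.genK1 q a b c d ^ x.2.2.1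
        * Zhedanov.genT1 q a b c d ^ (x.2.2.2 : ℕ)) = ⊤ := by
  refine ⟨⟨Zhedanov.polyRep hq ha hb hc hd, Zhedanov.polyRep_genK0 hq ha hb hc hd, fun f => ?_,
    fun f => ?_, Zhedanov.polyRep_injective hq hq1 ha hb hc hd⟩, Zhedanov.monomialSpan_eq_top⟩
  · rw [Zhedanov.polyRep_genK1]
    rfl
  · rw [Zhedanov.polyRep_genT1]
    exact Zhedanov.mul_opT1 a b f
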